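/- **Setting.** Fix a horizon $T$ and a budget $N$. The source $X_1,\dots,X_T$ and the channel noise $V_1,\dots,V_T$ are real random variables such that the pairs $(X_t,V_t)$ are i.i.d. *Source.* $X_t$ has a density $p_X$ that is even, log-concave, positive on all of $\mathbb{R}$, and continuously differentiable on $(0,\infty)$. *Noise.* $V_t$ has mean zero and finite variance $\sigma_V^2>0$; $V_t$ and $X_t$ are conditionally independent given $\operatorname{sgn}(X_t)$; and $\mathbb{E}[V_t^2\mid X_t>0]=\mathbb{E}[V_t^2\mid X_t<0]=\sigma_V^2$. *Scheduling.* Let $E_t$ be the number of transmission opportunities left at the beginning of time $t$: $E_1=N$, $E_{t+1}=E_t-U_t$. The sensor chooses $U_t=f_t(X_t,E_t)\in\{0,1\}$ ($1$ means "transmit") with $f_t$ measurable and $U_t\le E_t$, so that there are at most $N$ transmissions. A strategy $f=(f_1,\dots,f_T)$ is *admissible* if moreover, for all $1\le t\le T$ and $e>0$, the events conditioned on below have positive probability and $$\mathbb{E}[X_t\mid f_t(X_t,e)=1,X_t<0]<\mathbb{E}[X_t\mid f_t(X_t,e)=0]<\mathbb{E}[X_t\mid f_t(X_t,e)=1,X_t>0].$$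 *Encoding and decoding.* Let $P_T>0$, $\gamma=P_T/\sigma_V^2$, $S_t=\operatorname{sgn}(X_t)$. When $E_t=e$ write, for $s=\pm1$, $m(s)$ and $v(s)$ for the conditional mean and variance of $X_t$ given $f_t(X_t,e)=1$ and $S_t=s$, and $\alpha(s)=\sqrt{P_T/v(s)}$. If $U_t=1$, the encoder sends $Y_t=S_t\,\alpha(S_t)\,(X_t-m(S_t))$ over the noisy channel and $S_t$ over a noiseless side channel; the decoder receives $Y_t+V_t$ and $S_t$ and forms $$\hat X_t=S_t\,\frac{1}{\alpha(S_t)}\,\frac{\gamma}{\gamma+1}\,(Y_t+V_t)+m(S_t).$$ If $U_t=0$, the decoder is told so and forms $\hat X_t=\mathbb{E}[X_t\mid f_t(X_t,e)=0]$. *Cost.* Let $J_f(t,e)=\mathbb{E}\sum_{s=t}^{T}(X_s-\hat X_s)^2$ when the system is started at time $t$ with $E_t=e$ opportunities; the cost of $f$ is $J_f(1,N)$. Let $J^*(t,e)$ be the infimum of $J_f(t,e)$ over all admissible $f$ (so $J^*(T+1,\cdot)=0$), and for $e>0$ let $c(t,e)=J^*(t+1,e-1)-J^*(t+1,e)$ be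 the opportunity cost of a transmission. **Theorem 4.** For all $1\le t\le T$ and $e>0$ the equation $$\beta^2=\frac{1}{\gamma+1}\,G_X(\beta)^2+c(t,e),\qquad G_X(\beta)=\mathbb{E}[X_t\mid X_t>\beta]-\beta,\qquad \beta\ge 0,$$ has a unique solution $\beta_t^*(e)$. The strategy $$f_t^*(X_t,E_t)=\begin{cases}1,&\text{if }E_t>0\text{ and }|X_t|>\beta_t^*(E_t),\\0,&\text{if }E_t=0\text{ or }|X_t|\le\beta_t^*(E_t),\end{cases}$$ is admissible and optimal: $J_{f^*}(1,N)\le J_f(1,N)$ for every admissible $f$ and every $N$, and $J_{f^*}(t,e)=J^*(t,e)$ for all $1\le t\le T$ and all $e\ge0$. Moreover, it is the only admissible strategy of this symmetric threshold form that attains $J^*(t,e)$ for all $1\le t\le T$ and all $e\ge 0$. -/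

import Mathlib

open MeasureTheory ProbabilityTheory

noncomputable section

namespace RemoteEstimation

/-- The data of the scheduling and estimation problem: the horizon `T`, the underlying
probability measure `P`, the source `X t`, the channel noise `V t` (only the times
`t = 1, …, T` matter), the encoding power `P_T` and the noise variance `σ_V²`. -/
structure Model (Ω : Type*) [MeasurableSpace Ω] where
  T : ℕ
  P : Measure Ω
  X : ℕ → Ω → ℝ
  V : ℕ → Ω → ℝ
  power : ℝ
  noiseVar : ℝ

/-- The source density is even, log-concave, everywhere positive (its support is `ℝ`), and
continuously differentiable on `(0, ∞)`. -/
structure SourceDensity (pX : ℝ → ℝ) : Prop where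
  pos : ∀ x, 0 < pX x
  even : ∀ x, pX (-x) = pX x
  logConcave : ConcaveOn ℝ Set.univ (fun x => Real.log (pX x))
  contDiffOn : ContDiffOn ℝ 1 pX (Set.Ioi 0)

/-- A scheduling strategy: `f t x e = true` means that at time `t` the sensor transmits the
observation `x` when `e` transmission opportunities are left. -/
abbrev Strategy := ℕ → ℝ → ℕ → Bool

/-- The strategy that transmits iff an opportunity is left and `|x| > β t e`. -/
def thresholdStrategy (β : ℕ → ℕ → ℝ) : Strategy :=
  fun t x e => decide (0 < e ∧ β t e < |x|)

namespace Model

variable {Ω : Type*} [MeasurableSpace Ω] (M : Model Ω)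

/-- The pairs `(X_t, V_t)`, `1 ≤ t ≤ T`, are i.i.d., and `X_t` has density `pX`. -/
structure IsIIDSource (pX : ℝ → ℝ) : Prop where
  isProb : IsProbabilityMeasure M.P
  measurable_X : ∀ t ∈ Set.Icc 1 M.T, Measurable (M.X t)
  measurable_V : ∀ t ∈ Set.Icc 1 M.T, Measurable (M.V t)
  law : ∀ t ∈ Set.Icc 1 M.T,
    M.P.map (M.X t) = volume.withDensity (fun x => ENNReal.ofReal (pX x))
  indep : iIndepFun (fun (t : Set.Icc 1 M.T) ω => (M.X t ω, M.V t ω)) M.P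
  ident : ∀ s ∈ Set.Icc 1 M.T, ∀ t ∈ Set.Icc 1 M.T,
    IdentDistrib (fun ω => (M.X s ω, M.V s ω)) (fun ω => (M.X t ω, M.V t ω)) M.P M.P

/-- The event that the source at time `t` has sign `s`. -/
def signEvent (t : ℕ) (s : SignType) : Set Ω := {ω | SignType.sign (M.X t ω) = s}

/-- The channel noise has zero mean and finite variance `σ_V² > 0`, is independent of the source
conditionally on the sign of the source, and has the same power `σ_V²` for either sign. -/
structure ChannelNoise : Prop where
  var_pos : 0 < M.noiseVar
  memLp : ∀ t ∈ Set.Icc 1 M.T, MemLp (M.V t) 2 M.P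
  mean : ∀ t ∈ Set.Icc 1 M.T, ∫ ω, M.V t ω ∂M.P = 0
  variance : ∀ t ∈ Set.Icc 1 M.T, Var[M.V t; M.P] = M.noiseVar
  condIndep : ∀ t ∈ Set.Icc 1 M.T, ∀ s : SignType,
    IndepFun (M.V t) (M.X t) (M.P[|M.signEvent t s])
  condPower : ∀ t ∈ Set.Icc 1 M.T, ∀ s : SignType, s ≠ 0 →
    ∫ ω, M.V t ω ^ 2 ∂(M.P[|M.signEvent t s]) = M.noiseVar

/-- The signal-to-noise ratio `γ = P_T / σ_V²`. -/
def snr : ℝ := M.power / M.noiseVar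

/-- The event of no transmission at time `t` with `e` opportunities left. -/
def silent (f : Strategy) (t e : ℕ) : Set Ω := {ω | f t (M.X t ω) e = false}

/-- The event of a transmission at time `t` with `e` opportunities left and `sgn X_t = s`. -/
def sent (f : Strategy) (t e : ℕ) (s : SignType) : Set Ω :=
  {ω | f t (M.X t ω) e = true ∧ SignType.sign (M.X t ω) = s}

/-- `E[X_t | A]`. -/
def condMean (t : ℕ) (A : Set Ω) : ℝ := ∫ ω, M.X t ω ∂(M.P[|A])

/-- `Var(X_t | A)`. -/
def condVar (t : ℕ) (A : Set Ω) : ℝ := Var[M.X t; M.P[|A]]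

/-- The gain `α(s) = √(P_T / Var(X_t | U_t = 1, S_t = s))`. -/
def gain (f : Strategy) (t e : ℕ) (s : SignType) : ℝ :=
  Real.sqrt (M.power / M.condVar t (M.sent f t e s))

/-- The message from the sensor to the encoder; `none` is the free symbol `ε`. -/
def sensorMsg (f : Strategy) (t e : ℕ) (ω : Ω) : Option ℝ :=
  if f t (M.X t ω) e then some (M.X t ω) else none

/-- The piecewise affine encoder. -/
def encoder (f : Strategy) (t e : ℕ) : Option ℝ → ℝ
  | none => 0
  | some x => (SignType.sign x : ℝ) * M.gain f t e (SignType.sign x) *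
      (x - M.condMean t (M.sent f t e (SignType.sign x)))

/-- The channel output `Y_t + V_t` (which is `V_t` if nothing is transmitted). -/
def channelOut (f : Strategy) (t e : ℕ) (ω : Ω) : ℝ :=
  M.encoder f t e (M.sensorMsg f t e ω) + M.V t ω

/-- The message on the side channel: the sign of the transmitted observation, or `ε`. -/
def sideMsg (f : Strategy) (t e : ℕ) (ω : Ω) : Option SignType :=
  (M.sensorMsg f t e ω).map (fun x => SignType.sign x)

/-- The piecewise affine decoder. -/
def decoder (f : Strategy) (t e : ℕ) (y : ℝ) : Option SignType → ℝ
  | none => M.condMean t (M.silent f t e)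
  | some s => (s : ℝ) * (1 / M.gain f t e s) * (M.snr / (M.snr + 1)) * y +
      M.condMean t (M.sent f t e s)

/-- The estimate of `X_t` when `e` opportunities are left at time `t`. -/
def estimate (f : Strategy) (t e : ℕ) (ω : Ω) : ℝ :=
  M.decoder f t e (M.channelOut f t e ω) (M.sideMsg f t e ω)

/-- The number of opportunities left at the beginning of time `t + k`, if `e` were left at the
beginning of time `t`. -/
def budget (f : Strategy) (t e : ℕ) (ω : Ω) : ℕ → ℕ
  | 0 => e
  | k + 1 => budget f t e ω k - (f (t + k) (M.X (t + k) ω) (budget f t e ω k)).toNat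

/-- The expected cost `E ∑_{s = t}^{T} (X_s - X̂_s)²` of a strategy when the system is initialized
at time `t` with `e` opportunities. -/
def costToGo (f : Strategy) (t e : ℕ) : ℝ :=
  ∫ ω, ∑ k ∈ Finset.range (M.T + 1 - t),
    (M.X (t + k) ω - M.estimate f (t + k) (M.budget f t e ω k) ω) ^ 2 ∂M.P

/-- The admissible scheduling strategies: measurable, respecting the hard constraint
`U_t ≤ E_t`, and such that for every `e > 0`
`E[X_t | U_t = 1, X_t < 0] < E[X_t | U_t = 0] < E[X_t | U_t = 1, X_t > 0]`,
the three conditional expectations being well defined (events of positive probability). -/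
structure Admissible (f : Strategy) : Prop where
  measurable : ∀ t ∈ Set.Icc 1 M.T, ∀ e, Measurable (fun x => f t x e)
  hard : ∀ t ∈ Set.Icc 1 M.T, ∀ x e, (f t x e).toNat ≤ e
  silent_pos : ∀ t ∈ Set.Icc 1 M.T, ∀ e, 0 < e → 0 < M.P (M.silent f t e)
  sent_neg_pos : ∀ t ∈ Set.Icc 1 M.T, ∀ e, 0 < e → 0 < M.P (M.sent f t e (-1))
  sent_pos_pos : ∀ t ∈ Set.Icc 1 M.T, ∀ e, 0 < e → 0 < M.P (M.sent f t e 1)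
  neg_lt : ∀ t ∈ Set.Icc 1 M.T, ∀ e, 0 < e →
    M.condMean t (M.sent f t e (-1)) < M.condMean t (M.silent f t e)
  lt_pos : ∀ t ∈ Set.Icc 1 M.T, ∀ e, 0 < e →
    M.condMean t (M.silent f t e) < M.condMean t (M.sent f t e 1)

/-- The optimal cost to go `J*(t, e)`. -/
def optCost (t e : ℕ) : ℝ := sInf ((fun f => M.costToGo f t e) '' {f | M.Admissible f})

/-- The opportunity cost `c(t, e) = J*(t + 1, e - 1) - J*(t + 1, e)`, for `e > 0`. -/
def oppCost (t e : ℕ) : ℝ := M.optCost (t + 1) (e - 1) - M.optCost (t + 1) e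

/-- `G_X(β) = E[X_t | X_t > β] - β`. -/
def residual (t : ℕ) (b : ℝ) : ℝ := M.condMean t {ω | b < M.X t ω} - b

/-- `β` is a nonnegative solution of `β² = G_X(β)² / (γ + 1) + c(t, e)`. -/
def IsThreshold (t e : ℕ) (b : ℝ) : Prop :=
  0 ≤ b ∧ b ^ 2 = 1 / (M.snr + 1) * M.residual t b ^ 2 + M.oppCost t e

end Model

end RemoteEstimation

end

/-!
A strategy is determined at each time by its silent set `B`, so dynamic programming reduces the
problem to one step. Conditionally on the sign, the noise is uncorrelated with the source, and the
linear decoder leaves the fraction `κ = 1 / (γ + 1)` of the conditional variance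
(`setIntegral_sent_sq`). As the present is independent of the future, the cost-to-go satisfies a
Bellman equation (`costToGo_step`), in which a transmission has the price `c`, the opportunity
cost. What has to be shown is that the one-step cost `stageCost p κ c B` is smallest for
`B = [-β, β]` with `β² = κ G(β)² + c`, where `G` is the mean residual life.

* *Rearrangement* (`exists_Icc_stageCost_le`). Replace `B ∩ (0, ∞)` and `B ∩ (-∞, 0)` by the
  intervals `(0, r]` and `[-l, 0)` of the same masses. This lowers the first absolute moments and
  the variances of both halves (`moment_one_Ioc_le`, `scatter_Ioc_le`). For fixed masses the cost
  is a quadratic function of these first moments plus a multiple of the second moments, and the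
  ordering of the conditional means, which is what admissibility requires, gives the gradient of
  the quadratic the right sign (`stage_algebra`).
* *Centring* (`thresholdCost_le_stageCost_Icc`). For a log-concave density `G` decreases
  (`meanResidual_antitone`), and the unnormalized variance of the tail `(b, ∞)` has the derivative
  `-p(b) G(b)²`. Hence the cost of transmitting beyond `r` minus that of transmitting beyond `β`
  is at least `β²` times the mass of `(r, ∞)` minus that of `(β, ∞)` (`scatter_Ioi_sub_le`).
  What remains to be bounded below is `∫_B ((x - a)² - β²) p`, and Anderson's inequality for the
  even unimodal `p` shows that the least value is attained at `a = 0`, `B = [-β, β]`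
  (`integral_kernel_shift_le`).

Monotonicity of `G` also makes the balance equation uniquely solvable once `c ≥ 0`
(`existsUnique_isBalanced`), and any other symmetric threshold is strictly worse
(`thresholdCost_lt`). That `c ≥ 0` is part of the backward induction
(`optimal_thresholdStrategy`): the optimal one-step cost increases with `c` at a rate at most `1`,
and is at most the variance of the source, so an extra opportunity never hurts.
-/

noncomputable section

namespace RemoteEstimation

/-! ### Log-concave densities -/

namespace SourceDensity

variable {p : ℝ → ℝ}

lemma continuous (h : SourceDensity p) : Continuous p := by
  have hc : Continuous (fun x => Real.log (p x)) :=
    continuousOn_univ.1 (h.logConcave.continuousOn isOpen_univ)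
  have : p = fun x => Real.exp (Real.log (p x)) := by
    ext x; rw [Real.exp_log (h.pos x)]
  rw [this]
  exact Real.continuous_exp.comp hc

lemma le_of_abs_le (h : SourceDensity p) {x y : ℝ} (hxy : |x| ≤ |y|) : p y ≤ p x := by
  have habs : ∀ z, p |z| = p z := fun z => by
    rcases abs_choice z with hz | hz <;> simp [hz, h.even]
  have hx : x ∈ Set.Icc (-|y|) |y| := abs_le.1 hxy
  have := h.logConcave.min_le_of_mem_Icc (Set.mem_univ _) (Set.mem_univ _) hx
  rw [h.even, min_self, habs] at this
  exact (Real.log_le_log_iff (h.pos y) (h.pos x)).1 this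

lemma antitoneOn (h : SourceDensity p) {x y : ℝ} (hx : 0 ≤ x) (hxy : x ≤ y) : p y ≤ p x :=
  h.le_of_abs_le (by rwa [abs_of_nonneg hx, abs_of_nonneg (hx.trans hxy)])

/-- Log-concavity in product form: the likelihood ratio `p (x + s) / p x` decreases in `x`. -/
lemma mul_le_mul_shift (h : SourceDensity p) {a b s : ℝ} (hab : a ≤ b) (hs : 0 ≤ s) :
    p (b + s) * p a ≤ p (a + s) * p b := by
  rcases eq_or_lt_of_le (show a ≤ b + s by linarith) with h0 | h0
  · have h1 : b = a := by linarith
    have h2 : s = 0 := by linarith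
    simp [h1, h2]
  have hd : 0 < b + s - a := by linarith
  set t := s / (b + s - a) with ht
  have ht0 : 0 ≤ t := by positivity
  have ht1 : t ≤ 1 := by rw [ht, div_le_one hd]; linarith
  have htd : t * (b + s - a) = s := by rw [ht]; field_simp
  have c1 := h.logConcave.2 (Set.mem_univ a) (Set.mem_univ (b + s)) (sub_nonneg.2 ht1) ht0
    (by ring)
  have c2 := h.logConcave.2 (Set.mem_univ a) (Set.mem_univ (b + s)) ht0 (sub_nonneg.2 ht1)
    (by ring)
  simp only [smul_eq_mul] at c1 c2
  have e1 : (1 - t) * a + t * (b + s) = a + s := by linear_combination htd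
  have e2 : t * a + (1 - t) * (b + s) = b := by linear_combination -htd
  rw [e1] at c1
  rw [e2] at c2
  rw [← Real.log_le_log_iff (mul_pos (h.pos _) (h.pos _)) (mul_pos (h.pos _) (h.pos _)),
    Real.log_mul (h.pos _).ne' (h.pos _).ne', Real.log_mul (h.pos _).ne' (h.pos _).ne']
  linarith

/-- An integrable log-concave density has exponential tails. -/
lemma exists_exp_bound (h : SourceDensity p) (hi : Integrable p) :
    ∃ C k : ℝ, 0 < C ∧ 0 < k ∧ ∀ x, p x ≤ C * Real.exp (-k * |x|) := by
  obtain ⟨x₁, hx₁, hlt⟩ : ∃ x₁, 0 < x₁ ∧ p x₁ < p 0 := by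
    by_contra! hcon
    have hconst : p = fun _ => p 0 := by
      ext x
      refine le_antisymm (h.le_of_abs_le (by simp)) ?_
      rcases eq_or_ne x 0 with rfl | hx
      · rfl
      · refine (hcon |x| (abs_pos.2 hx)).trans (h.le_of_abs_le (by simp))
    rw [hconst, integrable_const_iff] at hi
    rcases hi with hi | hi
    · exact (h.pos 0).ne' hi
    · have := hi.measure_univ_lt_top
      simp at this
  set k := (Real.log (p 0) - Real.log (p x₁)) / x₁ with hk
  have hk0 : 0 < k := div_pos (sub_pos.2 (Real.log_lt_log (h.pos _) hlt)) hx₁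
  refine ⟨p 0 * Real.exp (k * x₁), k, mul_pos (h.pos 0) (Real.exp_pos _), hk0, fun x => ?_⟩
  rw [mul_assoc, ← Real.exp_add]
  rcases le_total |x| x₁ with hx | hx
  · have h1 : p x ≤ p 0 := h.le_of_abs_le (by simp)
    have h2 : 1 ≤ Real.exp (k * x₁ + -k * |x|) := Real.one_le_exp (by nlinarith)
    nlinarith [h.pos 0]
  · have hxpos : 0 < |x| := hx₁.trans_le hx
    have habs : p |x| = p x := by rcases abs_choice x with hz | hz <;> simp [hz, h.even]
    have ht1 : x₁ / |x| ≤ 1 := (div_le_one hxpos).2 hx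
    have ht0 : 0 ≤ x₁ / |x| := by positivity
    have c := h.logConcave.2 (Set.mem_univ 0) (Set.mem_univ |x|) (sub_nonneg.2 ht1) ht0 (by ring)
    simp only [smul_eq_mul, habs] at c
    have e : (1 - x₁ / |x|) * 0 + x₁ / |x| * |x| = x₁ := by field_simp; ring
    rw [e] at c
    have hkx : k * x₁ = Real.log (p 0) - Real.log (p x₁) := by rw [hk]; field_simp
    have h3 : Real.log (p x) ≤ Real.log (p 0) - k * |x| := by
      have : (x₁ / |x|) * (Real.log (p 0) - Real.log (p x) - k * |x|) ≥ 0 := by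
        have : (x₁ / |x|) * (k * |x|) = k * x₁ := by field_simp
        nlinarith
      have hpos : 0 < x₁ / |x| := by positivity
      have := nonneg_of_mul_nonneg_right this hpos
      linarith
    have h4 : p x ≤ p 0 * Real.exp (-k * |x|) := by
      rw [← Real.exp_log (h.pos x), ← Real.exp_log (h.pos 0), ← Real.exp_add]
      exact Real.exp_le_exp.2 (by linarith)
    refine h4.trans (mul_le_mul_of_nonneg_left (Real.exp_le_exp.2 ?_) (h.pos 0).le)
    nlinarith

lemma integrable_pow_mul (h : SourceDensity p) (hi : Integrable p) (n : ℕ) :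
    Integrable (fun x => x ^ n * p x) := by
  obtain ⟨C, k, hC, hk, hb⟩ := h.exists_exp_bound hi
  have hexp : Integrable (fun x : ℝ => Real.exp (-(k / 2) * |x|)) := by
    rw [← integrableOn_univ, ← Set.Iic_union_Ioi (a := (0 : ℝ))]
    refine IntegrableOn.union ?_ ?_
    · refine (integrableOn_congr_fun (g := fun x : ℝ => Real.exp ((k / 2) * x)) ?_
        measurableSet_Iic).2 (integrableOn_exp_mul_Iic (by positivity) 0)
      intro x hx
      simp only [abs_of_nonpos (Set.mem_Iic.1 hx)]
      congr 1; ring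
    · refine (integrableOn_congr_fun (g := fun x : ℝ => Real.exp (-(k / 2) * x)) ?_
        measurableSet_Ioi).2 (integrableOn_exp_mul_Ioi (by linarith) 0)
      intro x hx
      simp only [abs_of_pos (Set.mem_Ioi.1 hx)]
  refine (hexp.const_mul (C * (n.factorial / (k / 2) ^ n))).mono'
    (((continuous_pow n).mul h.continuous).aestronglyMeasurable) (Filter.Eventually.of_forall ?_)
  intro x
  rw [Real.norm_eq_abs, abs_mul, abs_pow, abs_of_pos (h.pos x)]
  have h1 : |x| ^ n ≤ n.factorial / (k / 2) ^ n * Real.exp (k / 2 * |x|) := by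
    have := Real.pow_div_factorial_le_exp (x := k / 2 * |x|) (by positivity) n
    rw [div_le_iff₀ (by positivity), mul_pow] at this
    rw [div_mul_eq_mul_div, le_div_iff₀ (by positivity)]
    linarith
  calc |x| ^ n * p x
      ≤ (n.factorial / (k / 2) ^ n * Real.exp (k / 2 * |x|)) * (C * Real.exp (-k * |x|)) :=
        mul_le_mul h1 (hb x) (h.pos x).le (by positivity)
    _ = C * (n.factorial / (k / 2) ^ n) * (Real.exp (k / 2 * |x|) * Real.exp (-k * |x|)) := by ring
    _ = _ := by rw [← Real.exp_add]; congr 2; ring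

end SourceDensity

/-! ### Moments of a density over a set -/

/-- The moment `∫_A x ^ k p(x) dx` of the density `p` over the set `A`. -/
def moment (p : ℝ → ℝ) (k : ℕ) (A : Set ℝ) : ℝ := ∫ x in A, x ^ k * p x

/-- The unnormalized variance `∫_A (x - m)² p(x) dx`, where `m` is the mean of `p` over `A`.
It is `0` when `A` carries no mass, because then all the moments vanish. -/
def scatter (p : ℝ → ℝ) (A : Set ℝ) : ℝ := moment p 2 A - moment p 1 A ^ 2 / moment p 0 A

variable {p : ℝ → ℝ}

lemma SourceDensity.integrable_quadratic (h : SourceDensity p) (hi : Integrable p) (a b c : ℝ) :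
    Integrable (fun x => (a * x ^ 2 + b * x + c) * p x) := by
  have := (((h.integrable_pow_mul hi 2).const_mul a).add
    ((h.integrable_pow_mul hi 1).const_mul b)).add ((h.integrable_pow_mul hi 0).const_mul c)
  refine this.congr (Filter.Eventually.of_forall fun x => ?_)
  simp only [Pi.add_apply]
  ring

lemma SourceDensity.setIntegral_quadratic (h : SourceDensity p) (hi : Integrable p) (a b c : ℝ)
    (A : Set ℝ) : ∫ x in A, (a * x ^ 2 + b * x + c) * p x =
      a * moment p 2 A + b * moment p 1 A + c * moment p 0 A := by
  have i2 := (h.integrable_pow_mul hi 2).integrableOn (s := A)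
  have i1 := (h.integrable_pow_mul hi 1).integrableOn (s := A)
  have i0 := (h.integrable_pow_mul hi 0).integrableOn (s := A)
  simp only [moment, ← integral_const_mul]
  have e := integral_add ((i2.const_mul a).add (i1.const_mul b)) (i0.const_mul c)
  simp only [Pi.add_apply] at e
  rw [← integral_add (i2.const_mul a) (i1.const_mul b), ← e]
  congr 1
  ext x
  ring

lemma moment_neg_preimage (h : SourceDensity p) (k : ℕ) (A : Set ℝ) :
    moment p k (Neg.neg ⁻¹' A) = (-1) ^ k * moment p k A := by
  unfold moment
  rw [← (Measure.measurePreserving_neg (volume : Measure ℝ)).setIntegral_preimage_emb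
    (MeasurableEquiv.neg ℝ).measurableEmbedding (fun x => x ^ k * p x) A, ← integral_const_mul]
  congr 1
  ext x
  rw [h.even, ← mul_assoc, ← mul_pow]
  simp

lemma moment_union (h : SourceDensity p) (hi : Integrable p) (k : ℕ) {A B : Set ℝ}
    (hB : MeasurableSet B) (hd : Disjoint A B) :
    moment p k (A ∪ B) = moment p k A + moment p k B :=
  setIntegral_union hd hB (h.integrable_pow_mul hi k).integrableOn
    (h.integrable_pow_mul hi k).integrableOn

lemma moment_add_compl (h : SourceDensity p) (hi : Integrable p) (k : ℕ) {A : Set ℝ}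
    (hA : MeasurableSet A) : moment p k A + moment p k Aᶜ = moment p k Set.univ := by
  rw [← moment_union h hi k hA.compl disjoint_compl_right, Set.union_compl_self]

lemma moment_congr_ae {k : ℕ} {A B : Set ℝ} (hAB : A =ᵐ[volume] B) :
    moment p k A = moment p k B := setIntegral_congr_set hAB

lemma moment_zero_nonneg (h : SourceDensity p) (A : Set ℝ) : 0 ≤ moment p 0 A :=
  integral_nonneg fun x => by simpa using (h.pos x).le

lemma moment_one_nonneg (h : SourceDensity p) {A : Set ℝ} (hA : MeasurableSet A)
    (hpos : ∀ x ∈ A, 0 ≤ x) : 0 ≤ moment p 1 A :=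
  setIntegral_nonneg hA fun x hx => mul_nonneg (by simpa using hpos x hx) (h.pos x).le

lemma volume_eq_zero_of_moment_zero (h : SourceDensity p) (hi : Integrable p) {A : Set ℝ}
    (h0 : moment p 0 A = 0) : volume A = 0 := by
  unfold moment at h0
  simp only [pow_zero, one_mul] at h0
  have := (integral_eq_zero_iff_of_nonneg (μ := volume.restrict A) (fun x => (h.pos x).le)
    hi.integrableOn).1 h0
  by_contra hne
  have hbot : (ae (volume.restrict A)).NeBot := by
    rw [ae_neBot]
    simpa using hne
  obtain ⟨x, hx⟩ := this.exists
  exact (h.pos x).ne' hx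

lemma moment_eq_zero_of_moment_zero (h : SourceDensity p) (hi : Integrable p) {A : Set ℝ}
    (h0 : moment p 0 A = 0) (k : ℕ) : moment p k A = 0 := by
  unfold moment
  rw [Measure.restrict_eq_zero.2 (volume_eq_zero_of_moment_zero h hi h0), integral_zero_measure]

/-- The bathtub principle: if `f` is nonpositive on what `B` leaves out of `A` and nonnegative on
what `B` adds to `A`, then the integral of `f` over `B` is the larger one. -/
lemma setIntegral_le_of_sign (h : SourceDensity p) (hi : Integrable p) (a b c : ℝ) {A B : Set ℝ}
    (hA : MeasurableSet A) (hB : MeasurableSet B)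
    (h₁ : ∀ x ∈ A, x ∉ B → a * x ^ 2 + b * x + c ≤ 0)
    (h₂ : ∀ x ∈ B, x ∉ A → 0 ≤ a * x ^ 2 + b * x + c) :
    ∫ x in A, (a * x ^ 2 + b * x + c) * p x ≤ ∫ x in B, (a * x ^ 2 + b * x + c) * p x := by
  have hq := h.integrable_quadratic hi a b c
  rw [← integral_indicator hA, ← integral_indicator hB]
  refine integral_mono (hq.indicator hA) (hq.indicator hB) fun x => ?_
  by_cases hxA : x ∈ A <;> by_cases hxB : x ∈ B <;> simp only [Set.indicator, hxA, hxB, if_true,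
    if_false, le_refl]
  · exact mul_nonpos_of_nonpos_of_nonneg (h₁ x hxA hxB) (h.pos x).le
  · exact mul_nonneg (h₂ x hxB hxA) (h.pos x).le

/-! ### Tails and the mean residual life -/

lemma hasDerivAt_moment_Ioi (h : SourceDensity p) (hi : Integrable p) (k : ℕ) (b : ℝ) :
    HasDerivAt (fun b => moment p k (Set.Ioi b)) (-(b ^ k * p b)) b := by
  have hik := h.integrable_pow_mul hi k
  have heq : (fun b => moment p k (Set.Ioi b)) =
      fun b => moment p k (Set.Ioi 0) - ∫ x in (0 : ℝ)..b, x ^ k * p x := by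
    ext b
    have := intervalIntegral.integral_Ioi_sub_Ioi' (a := (0 : ℝ)) (b := b) (μ := volume)
      hik.integrableOn hik.integrableOn
    unfold moment
    rw [← this]
    ring
  have hc : Continuous fun x => x ^ k * p x := (continuous_pow k).mul h.continuous
  rw [heq]
  exact (intervalIntegral.integral_hasDerivAt_right hik.intervalIntegrable
    hc.aestronglyMeasurable.stronglyMeasurableAtFilter hc.continuousAt).const_sub _

lemma moment_zero_Ioi_pos (h : SourceDensity p) (hi : Integrable p) (b : ℝ) :
    0 < moment p 0 (Set.Ioi b) := by
  refine lt_of_le_of_ne (moment_zero_nonneg h _) fun h0 => ?_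
  have := volume_eq_zero_of_moment_zero h hi h0.symm
  simp at this

/-- The mean residual life `E[X | X > b] - b` of a density. -/
def meanResidual (p : ℝ → ℝ) (b : ℝ) : ℝ :=
  moment p 1 (Set.Ioi b) / moment p 0 (Set.Ioi b) - b

lemma meanResidual_pos (h : SourceDensity p) (hi : Integrable p) (b : ℝ) :
    0 < meanResidual p b := by
  have hQ := moment_zero_Ioi_pos h hi b
  have hlin := h.setIntegral_quadratic hi 0 1 (-b) (Set.Ioi b)
  have hnn : 0 ≤ ∫ x in Set.Ioi b, (0 * x ^ 2 + 1 * x + -b) * p x :=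
    setIntegral_nonneg measurableSet_Ioi fun x hx =>
      mul_nonneg (by have := Set.mem_Ioi.1 hx; linarith) (h.pos x).le
  have hne : ∫ x in Set.Ioi b, (0 * x ^ 2 + 1 * x + -b) * p x ≠ 0 := by
    intro h0
    rw [setIntegral_eq_zero_iff_of_nonneg_ae] at h0
    · have hbot : (ae (volume.restrict (Set.Ioi b))).NeBot := by
        rw [ae_neBot]
        simp
      obtain ⟨x, hx, hxb⟩ := (h0.and (ae_restrict_mem measurableSet_Ioi)).exists
      have hxb := Set.mem_Ioi.1 hxb
      have : 0 < (0 * x ^ 2 + 1 * x + -b) * p x := mul_pos (by linarith) (h.pos x)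
      exact this.ne' hx
    · filter_upwards [ae_restrict_mem measurableSet_Ioi] with x hx
      exact mul_nonneg (by have := Set.mem_Ioi.1 hx; linarith) (h.pos x).le
    · exact (h.integrable_quadratic hi 0 1 (-b)).integrableOn
  have hpos := lt_of_le_of_ne hnn hne.symm
  rw [hlin] at hpos
  unfold meanResidual
  rw [sub_pos, lt_div_iff₀ hQ]
  linarith

/-- Log-concavity makes the mean residual life decrease: with `g = E[X - b | X > b]`, the signed
weight `(y - b - g)` changes sign at `b + g`, and passing from `p` to its shift by `b' - b`
multiplies `p` by a decreasing factor. -/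
lemma meanResidual_antitone (h : SourceDensity p) (hi : Integrable p) :
    Antitone (meanResidual p) := by
  intro b b' hbb
  set g := meanResidual p b with hg
  set d := b' - b with hd
  have hd0 : 0 ≤ d := sub_nonneg.2 hbb
  have hQ := moment_zero_Ioi_pos h hi b
  have hQ' := moment_zero_Ioi_pos h hi b'
  have hlin : ∫ x in Set.Ioi b, (0 * x ^ 2 + 1 * x + -(b + g)) * p x = 0 := by
    rw [h.setIntegral_quadratic hi, hg, meanResidual]
    field_simp
    ring
  have hshift : ∫ x in Set.Ioi b, (0 * (x + d) ^ 2 + 1 * (x + d) + -(b' + g)) * p (x + d) =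
      ∫ x in Set.Ioi b', (0 * x ^ 2 + 1 * x + -(b' + g)) * p x := by
    rw [← (measurePreserving_add_right (volume : Measure ℝ) d).setIntegral_preimage_emb
      (measurableEmbedding_addRight d) (fun x => (0 * x ^ 2 + 1 * x + -(b' + g)) * p x)
      (Set.Ioi b')]
    rw [Set.preimage_add_const_Ioi, hd, sub_sub_cancel]
  have hpt : ∀ y, p (b + g) * ((0 * (y + d) ^ 2 + 1 * (y + d) + -(b' + g)) * p (y + d)) ≤
      p (b + g + d) * ((0 * y ^ 2 + 1 * y + -(b + g)) * p y) := by
    intro y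
    rcases le_total (b + g) y with hy | hy
    · have := h.mul_le_mul_shift hy hd0
      have h2 : 0 ≤ y - (b + g) := sub_nonneg.2 hy
      have h3 := mul_le_mul_of_nonneg_left this h2
      rw [hd] at h3 ⊢
      linarith
    · have := h.mul_le_mul_shift hy hd0
      have h2 : 0 ≤ (b + g) - y := sub_nonneg.2 hy
      have h3 := mul_le_mul_of_nonneg_left this h2
      rw [hd] at h3 ⊢
      linarith
  have hmono := setIntegral_mono (s := Set.Ioi b) (μ := volume)
    (((h.integrable_quadratic hi 0 1 (-(b' + g))).comp_add_right d).const_mul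
      (p (b + g))).integrableOn
    ((h.integrable_quadratic hi 0 1 (-(b + g))).const_mul (p (b + g + d))).integrableOn hpt
  rw [integral_const_mul, integral_const_mul, hlin, mul_zero, hshift] at hmono
  have hle := nonpos_of_mul_nonpos_right hmono (h.pos _)
  rw [h.setIntegral_quadratic hi] at hle
  rw [meanResidual, sub_le_iff_le_add, div_le_iff₀ hQ']
  linarith

lemma continuous_meanResidual (h : SourceDensity p) (hi : Integrable p) :
    Continuous (meanResidual p) := by
  have hc : ∀ k, Continuous (fun b => moment p k (Set.Ioi b)) := fun k =>
    continuous_iff_continuousAt.2 fun b => (hasDerivAt_moment_Ioi h hi k b).continuousAt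
  exact ((hc 1).div (hc 0) fun b => (moment_zero_Ioi_pos h hi b).ne').sub continuous_id

/-- The unnormalized variance of the tail decreases at the rate `p(b) E[X - b | X > b] ^ 2`;
since the mean residual life decreases, its increments compare with those of the mass. -/
lemma scatter_Ioi_sub_le (h : SourceDensity p) (hi : Integrable p) (b r : ℝ) :
    scatter p (Set.Ioi b) - scatter p (Set.Ioi r) ≤
      meanResidual p b ^ 2 * (moment p 0 (Set.Ioi b) - moment p 0 (Set.Ioi r)) := by
  set D : ℝ → ℝ := fun x => scatter p (Set.Ioi x) - meanResidual p b ^ 2 * moment p 0 (Set.Ioi x)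
    with hD
  have hder : ∀ x, HasDerivAt D (p x * (meanResidual p b ^ 2 - meanResidual p x ^ 2)) x := by
    intro x
    have hQ := (moment_zero_Ioi_pos h hi x).ne'
    have d0 := hasDerivAt_moment_Ioi h hi 0 x
    have d1 := hasDerivAt_moment_Ioi h hi 1 x
    have d2 := hasDerivAt_moment_Ioi h hi 2 x
    have := (d2.sub ((d1.pow 2).div d0 hQ)).sub (d0.const_mul (meanResidual p b ^ 2))
    refine this.congr_deriv ?_
    simp only [Pi.pow_apply]
    generalize meanResidual p b = g
    rw [meanResidual]
    field_simp
    ring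
  suffices D b ≤ D r by
    simp only [hD] at this
    linarith
  have hcont : Continuous D := continuous_iff_continuousAt.2 fun x => (hder x).continuousAt
  rcases le_total b r with hbr | hbr
  · refine monotoneOn_of_deriv_nonneg (convex_Ici b) hcont.continuousOn
      (fun x _ => (hder x).differentiableAt.differentiableWithinAt) ?_ (Set.mem_Ici.2 le_rfl)
      (Set.mem_Ici.2 hbr) hbr
    intro x hx
    rw [interior_Ici, Set.mem_Ioi] at hx
    rw [(hder x).deriv]
    refine mul_nonneg (h.pos x).le (sub_nonneg.2 ?_)
    exact pow_le_pow_left₀ (meanResidual_pos h hi x).le (meanResidual_antitone h hi hx.le) 2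
  · refine antitoneOn_of_deriv_nonpos (convex_Iic b) hcont.continuousOn
      (fun x _ => (hder x).differentiableAt.differentiableWithinAt) ?_ (Set.mem_Iic.2 hbr)
      (Set.mem_Iic.2 le_rfl) hbr
    intro x hx
    rw [interior_Iic, Set.mem_Iio] at hx
    rw [(hder x).deriv]
    refine mul_nonpos_of_nonneg_of_nonpos (h.pos x).le (sub_nonpos.2 ?_)
    exact pow_le_pow_left₀ (meanResidual_pos h hi b).le (meanResidual_antitone h hi hx.le) 2

/-! ### Centred intervals are the best silent sets -/

/-- Anderson's inequality on the line for the kernel `max 0 (b² - x²)`: since the density is even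
and unimodal, its integral against the translated kernel is largest without translation. -/
lemma integral_kernel_shift_le (h : SourceDensity p) (hi : Integrable p) (b a : ℝ) :
    ∫ x, max 0 (b ^ 2 - (x - a) ^ 2) * p x ≤ ∫ x, max 0 (b ^ 2 - x ^ 2) * p x := by
  set w : ℝ → ℝ := fun x => max 0 (b ^ 2 - x ^ 2) with hw
  have hwc : Continuous w := by fun_prop
  have hwb : ∀ x, ‖w x‖ ≤ b ^ 2 := fun x => by
    rw [Real.norm_eq_abs, abs_of_nonneg (le_max_left _ _)]
    exact max_le (sq_nonneg b) (by nlinarith [sq_nonneg x])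
  have hint : ∀ g : ℝ → ℝ, Continuous g → Integrable (fun x => w (g x) * p x) := fun g hg =>
    hi.bdd_mul (hwc.comp hg).aestronglyMeasurable (Filter.Eventually.of_forall fun x => hwb (g x))
  have i1 := hint (fun x => x) continuous_id
  have i2 := hint (fun x => x - a) (by fun_prop)
  change ∫ x, w (x - a) * p x ≤ ∫ x, w x * p x
  set f : ℝ → ℝ := fun x => w x * p x - w (x - a) * p x with hf
  have hif : Integrable f := i1.sub i2
  have hpt : ∀ x, 0 ≤ f x + f (a - x) := by
    intro x
    have hev : w (a - x) = w (x - a) := by simp only [hw]; ring_nf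
    have hev' : w (a - x - a) = w x := by simp only [hw]; ring_nf
    have hfac : f x + f (a - x) = (w x - w (x - a)) * (p x - p (a - x)) := by
      simp only [hf, hev, hev']
      ring
    have hpe : p (a - x) = p (x - a) := by rw [← h.even, neg_sub]
    rw [hfac, hpe]
    rcases le_total |x| |x - a| with hx | hx
    · refine mul_nonneg (sub_nonneg.2 (max_le_max le_rfl ?_)) (sub_nonneg.2 (h.le_of_abs_le hx))
      linarith [sq_le_sq.2 hx]
    · refine mul_nonneg_of_nonpos_of_nonpos (sub_nonpos.2 (max_le_max le_rfl ?_))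
        (sub_nonpos.2 (h.le_of_abs_le hx))
      linarith [sq_le_sq.2 hx]
  have hsum : 0 ≤ ∫ x, (f x + f (a - x)) := integral_nonneg hpt
  rw [integral_add hif (hif.comp_sub_left a), integral_sub_left_eq_self f volume a] at hsum
  have : ∫ x, f x = (∫ x, w x * p x) - ∫ x, w (x - a) * p x := integral_sub i1 i2
  linarith

lemma moment_Icc_le_quadratic (h : SourceDensity p) (hi : Integrable p) {b : ℝ} (hb : 0 ≤ b)
    (a : ℝ) {B : Set ℝ} (hB : MeasurableSet B) :
    moment p 2 (Set.Icc (-b) b) - b ^ 2 * moment p 0 (Set.Icc (-b) b) ≤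
      moment p 2 B - 2 * a * moment p 1 B + (a ^ 2 - b ^ 2) * moment p 0 B := by
  have hwb : ∀ a x, ‖max 0 (b ^ 2 - (x - a) ^ 2)‖ ≤ b ^ 2 := fun a x => by
    rw [Real.norm_eq_abs, abs_of_nonneg (le_max_left _ _)]
    exact max_le (sq_nonneg b) (by nlinarith [sq_nonneg (x - a)])
  have hint : ∀ a, Integrable (fun x => max 0 (b ^ 2 - (x - a) ^ 2) * p x) := fun a =>
    hi.bdd_mul (by fun_prop) (Filter.Eventually.of_forall fun x => hwb a x)
  have h1 : -∫ x, max 0 (b ^ 2 - (x - a) ^ 2) * p x ≤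
      ∫ x in B, (1 * x ^ 2 + (-(2 * a)) * x + (a ^ 2 - b ^ 2)) * p x := by
    rw [← integral_neg, ← integral_indicator hB]
    refine integral_mono (hint a).neg ((h.integrable_quadratic hi _ _ _).indicator hB) fun x => ?_
    by_cases hx : x ∈ B
    · simp only [Set.indicator_of_mem hx]
      rw [← neg_mul]
      refine mul_le_mul_of_nonneg_right ?_ (h.pos x).le
      nlinarith [le_max_right 0 (b ^ 2 - (x - a) ^ 2)]
    · simp only [Set.indicator_of_notMem hx]
      rw [neg_nonpos]
      exact mul_nonneg (le_max_left _ _) (h.pos x).le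
  have h2 : -∫ x, max 0 (b ^ 2 - x ^ 2) * p x =
      ∫ x in Set.Icc (-b) b, (1 * x ^ 2 + 0 * x + (-b ^ 2)) * p x := by
    rw [← integral_neg, ← integral_indicator measurableSet_Icc]
    congr 1
    ext x
    by_cases hx : x ∈ Set.Icc (-b) b
    · have : x ^ 2 ≤ b ^ 2 := sq_le_sq' hx.1 hx.2
      rw [Set.indicator_of_mem hx, max_eq_right (by linarith)]
      ring
    · have : b ^ 2 ≤ x ^ 2 := by
        by_contra! hcon
        exact hx (abs_le.1 (abs_le_of_sq_le_sq hcon.le hb))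
      rw [Set.indicator_of_notMem hx, max_eq_left (by linarith)]
      ring
  have h3 := integral_kernel_shift_le h hi b a
  rw [h.setIntegral_quadratic hi] at h1 h2
  linarith

lemma moment_Icc_le_scatter (h : SourceDensity p) (hi : Integrable p) {b : ℝ} (hb : 0 ≤ b)
    {B : Set ℝ} (hB : MeasurableSet B) :
    moment p 2 (Set.Icc (-b) b) - b ^ 2 * moment p 0 (Set.Icc (-b) b) ≤
      scatter p B - b ^ 2 * moment p 0 B := by
  refine (moment_Icc_le_quadratic h hi hb (moment p 1 B / moment p 0 B) hB).trans (le_of_eq ?_)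
  unfold scatter
  rcases eq_or_ne (moment p 0 B) 0 with h0 | h0
  · simp [h0]
  · field_simp
    ring

/-! ### Pushing a half-line set towards the origin -/

/-- Among the subsets of `(0, ∞)` of a given mass, the interval at the origin has the smallest
mean. -/
lemma moment_one_Ioc_le (h : SourceDensity p) (hi : Integrable p) {r : ℝ} {B : Set ℝ}
    (hB : MeasurableSet B) (hBpos : B ⊆ Set.Ioi 0)
    (hmass : moment p 0 (Set.Ioc 0 r) = moment p 0 B) :
    moment p 1 (Set.Ioc 0 r) ≤ moment p 1 B := by
  have := setIntegral_le_of_sign h hi 0 1 (-r) (measurableSet_Ioc (a := 0) (b := r)) hB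
    (fun x hx _ => by linarith [hx.2])
    (fun x hx hn => by
      have : r < x := by
        by_contra! hcon
        exact hn ⟨hBpos hx, hcon⟩
      linarith)
  rw [h.setIntegral_quadratic hi, h.setIntegral_quadratic hi, hmass] at this
  linarith

/-- Among the subsets of `(0, ∞)` of a given mass, the interval at the origin has the smallest
variance. If the mean `a` of `B` is at most `r / 2`, the bathtub principle for `(x - a)²` shows
this; otherwise `B` is compared with the interval of length `r` centred at `a`, which the
unimodal density charges less than `(0, r]`. -/
lemma scatter_Ioc_le (h : SourceDensity p) (hi : Integrable p) {r : ℝ} (hr : 0 ≤ r) {B : Set ℝ}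
    (hB : MeasurableSet B) (hBpos : B ⊆ Set.Ioi 0)
    (hmass : moment p 0 (Set.Ioc 0 r) = moment p 0 B) :
    scatter p (Set.Ioc 0 r) ≤ scatter p B := by
  rcases (moment_zero_nonneg h B).eq_or_lt with h0 | hq
  · simp [scatter, moment_eq_zero_of_moment_zero h hi h0.symm,
      moment_eq_zero_of_moment_zero h hi (hmass.trans h0.symm)]
  set q := moment p 0 B with hqdef
  set a := moment p 1 B / q with ha
  have hu : moment p 1 B = a * q := by rw [ha]; field_simp
  have ha0 : 0 ≤ a := div_nonneg (moment_one_nonneg h hB fun x hx => (hBpos hx).le) hq.le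
  have key : ∀ m, moment p 2 (Set.Ioc 0 r) - 2 * m * moment p 1 (Set.Ioc 0 r) + m ^ 2 * q ≤
      moment p 2 B - 2 * a * moment p 1 B + a ^ 2 * q →
      scatter p (Set.Ioc 0 r) ≤ scatter p B := by
    intro m hm
    have e1 : moment p 1 B ^ 2 / q = a ^ 2 * q := by rw [hu]; field_simp
    have e2 : 2 * m * moment p 1 (Set.Ioc 0 r) - m ^ 2 * q ≤ moment p 1 (Set.Ioc 0 r) ^ 2 / q := by
      rw [le_div_iff₀ hq]
      nlinarith [sq_nonneg (moment p 1 (Set.Ioc 0 r) - m * q)]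
    unfold scatter
    rw [hmass, ← hqdef, e1]
    rw [hu] at hm
    linarith
  rcases le_total a (r / 2) with har | har
  · refine key a ?_
    have := setIntegral_le_of_sign h hi 1 (-(2 * a)) (2 * a * r - r ^ 2)
      (measurableSet_Ioc (a := 0) (b := r)) hB
      (fun x hx _ => by
        have : (x - r) * (x + r - 2 * a) ≤ 0 :=
          mul_nonpos_of_nonpos_of_nonneg (by linarith [hx.2]) (by linarith [hx.1])
        linarith)
      (fun x hx hn => by
        have hrx : r < x := by
          by_contra! hcon
          exact hn ⟨hBpos hx, hcon⟩
        have : 0 ≤ (x - r) * (x + r - 2 * a) := mul_nonneg (by linarith) (by linarith)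
        linarith)
    rw [h.setIntegral_quadratic hi, h.setIntegral_quadratic hi, hmass, ← hqdef] at this
    linarith
  · refine key (r / 2) ?_
    set d := a - r / 2 with hd
    have hd0 : 0 ≤ d := sub_nonneg.2 har
    have h1 := setIntegral_le_of_sign h hi 1 (-(2 * a)) (a ^ 2 - (r / 2) ^ 2)
      (measurableSet_Ioc (a := d) (b := r + d)) hB
      (fun x hx _ => by
        have : (x - a - r / 2) * (x - a + r / 2) ≤ 0 :=
          mul_nonpos_of_nonpos_of_nonneg (by linarith [hx.2]) (by linarith [hx.1])
        linarith)
      (fun x _ hn => by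
        rcases le_or_gt x d with hx | hx
        · have : 0 ≤ (x - a - r / 2) * (x - a + r / 2) :=
            mul_nonneg_of_nonpos_of_nonpos (by linarith) (by linarith)
          linarith
        · have hx' : r + d < x := by
            by_contra! hcon
            exact hn ⟨hx, hcon⟩
          have : 0 ≤ (x - a - r / 2) * (x - a + r / 2) := mul_nonneg (by linarith) (by linarith)
          linarith)
    rw [h.setIntegral_quadratic hi 1 _ _ B, ← hqdef] at h1
    have h2 : ∫ x in Set.Ioc d (r + d), (1 * x ^ 2 + -(2 * a) * x + (a ^ 2 - (r / 2) ^ 2)) * p x =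
        ∫ x in Set.Ioc 0 r, (1 * x ^ 2 + -r * x + 0) * p (x + d) := by
      rw [← (measurePreserving_add_right (volume : Measure ℝ) d).setIntegral_preimage_emb
        (measurableEmbedding_addRight d)
        (fun x => (1 * x ^ 2 + -(2 * a) * x + (a ^ 2 - (r / 2) ^ 2)) * p x)
        (Set.Ioc d (r + d)), Set.preimage_add_const_Ioc, sub_self, add_sub_cancel_right]
      congr 1
      ext x
      have : a = d + r / 2 := by rw [hd]; ring
      rw [this]
      ring
    have h3 : ∫ x in Set.Ioc 0 r, (1 * x ^ 2 + -r * x + 0) * p x ≤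
        ∫ x in Set.Ioc 0 r, (1 * x ^ 2 + -r * x + 0) * p (x + d) := by
      refine setIntegral_mono_on (h.integrable_quadratic hi _ _ _).integrableOn ?_
        measurableSet_Ioc ?_
      · have hc : Continuous fun x => (1 * x ^ 2 + -r * x + 0) * p (x + d) := by
          have := h.continuous
          fun_prop
        exact (hc.integrableOn_Icc (a := 0) (b := r)).mono_set Set.Ioc_subset_Icc_self
      · intro x hx
        refine mul_le_mul_of_nonpos_left (h.antitoneOn hx.1.le (by linarith)) ?_
        nlinarith [hx.1, hx.2]
    rw [h.setIntegral_quadratic hi] at h3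
    linarith

lemma exists_moment_zero_Ioi_eq (h : SourceDensity p) (hi : Integrable p) {y : ℝ} (hy : 0 < y)
    (hy' : y ≤ moment p 0 (Set.Ioi 0)) : ∃ r, 0 ≤ r ∧ moment p 0 (Set.Ioi r) = y := by
  have hik := h.integrable_pow_mul hi 0
  have hlim : Filter.Tendsto (fun r => moment p 0 (Set.Ioi 0) - ∫ x in (0 : ℝ)..r, x ^ 0 * p x)
      Filter.atTop (nhds 0) := by
    have := (intervalIntegral_tendsto_integral_Ioi (0 : ℝ) hik.integrableOn
      Filter.tendsto_id).const_sub (moment p 0 (Set.Ioi 0))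
    simpa [moment] using this
  obtain ⟨R, hR, hR0⟩ := ((hlim.eventually_lt_const hy).and (Filter.eventually_ge_atTop 0)).exists
  have heq : moment p 0 (Set.Ioi R) = moment p 0 (Set.Ioi 0) - ∫ x in (0 : ℝ)..R, x ^ 0 * p x := by
    have := intervalIntegral.integral_Ioi_sub_Ioi' (a := (0 : ℝ)) (b := R) (μ := volume)
      hik.integrableOn hik.integrableOn
    unfold moment
    rw [← this]
    ring
  rw [← heq] at hR
  have hc : Continuous (fun b => moment p 0 (Set.Ioi b)) :=
    continuous_iff_continuousAt.2 fun b => (hasDerivAt_moment_Ioi h hi 0 b).continuousAt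
  obtain ⟨r, hr, hry⟩ := intermediate_value_Icc' hR0 hc.continuousOn ⟨hR.le, hy'⟩
  exact ⟨r, hr.1, hry⟩

/-! ### The one-step problem -/

/-- The expected cost of one step when the sensor is silent exactly on `B`: the squared error of
the mean on the silent set, `κ` times the squared error of the mean on either transmitted half
line, and a price `c` for a transmission. -/
def stageCost (p : ℝ → ℝ) (κ c : ℝ) (B : Set ℝ) : ℝ :=
  scatter p B + κ * (scatter p (Bᶜ ∩ Set.Ioi 0) + scatter p (Bᶜ ∩ Set.Iio 0)) +
    c * (moment p 0 (Bᶜ ∩ Set.Ioi 0) + moment p 0 (Bᶜ ∩ Set.Iio 0))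

lemma scatter_neg_preimage (h : SourceDensity p) (A : Set ℝ) :
    scatter p (Neg.neg ⁻¹' A) = scatter p A := by
  simp only [scatter, moment_neg_preimage h, even_two.neg_one_pow, pow_zero, pow_one, one_mul, neg_mul,
    neg_sq]

lemma moment_inter_add_inter (h : SourceDensity p) (hi : Integrable p) (k : ℕ) {B : Set ℝ}
    (hB : MeasurableSet B) :
    moment p k (B ∩ Set.Ioi 0) + moment p k (B ∩ Set.Iio 0) = moment p k B := by
  have hd : Disjoint (B ∩ Set.Ioi (0 : ℝ)) (B ∩ Set.Iio 0) :=
    Set.disjoint_left.2 fun x hx hx' => lt_asymm (Set.mem_Ioi.1 hx.2) (Set.mem_Iio.1 hx'.2)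
  rw [← moment_union h hi k (hB.inter measurableSet_Iio) hd, ← Set.inter_union_distrib_left,
    Set.union_comm, Set.Iio_union_Ioi]
  refine moment_congr_ae ?_
  have : ({0}ᶜ : Set ℝ) =ᵐ[volume] Set.univ := by
    rw [ae_eq_univ, compl_compl]
    exact Real.volume_singleton
  simpa using (ae_eq_refl B).inter this

lemma moment_zero_Ioi_zero (h : SourceDensity p) (hi : Integrable p)
    (h1 : moment p 0 Set.univ = 1) : moment p 0 (Set.Ioi 0) = 1 / 2 := by
  have e := moment_inter_add_inter h hi 0 MeasurableSet.univ
  have e2 := moment_neg_preimage h 0 (Set.Ioi 0)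
  rw [Set.univ_inter, Set.univ_inter, h1] at e
  simp only [Set.neg_preimage, Set.neg_Ioi, neg_zero, pow_zero, one_mul] at e2
  linarith

lemma moment_compl_inter_Ioi (h : SourceDensity p) (hi : Integrable p) (k : ℕ) {B : Set ℝ}
    (hB : MeasurableSet B) :
    moment p k (Bᶜ ∩ Set.Ioi 0) = moment p k (Set.Ioi 0) - moment p k (B ∩ Set.Ioi 0) := by
  have hd : Disjoint (B ∩ Set.Ioi (0 : ℝ)) (Bᶜ ∩ Set.Ioi 0) :=
    Set.disjoint_left.2 fun x hx hx' => hx'.1 hx.1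
  have := moment_union h hi k (hB.compl.inter measurableSet_Ioi) hd
  rw [← Set.union_inter_distrib_right, Set.union_compl_self, Set.univ_inter] at this
  linarith

/-- The part of `B` on the negative half line, reflected to the positive one. -/
def negPart (B : Set ℝ) : Set ℝ := Neg.neg ⁻¹' B ∩ Set.Ioi 0

lemma negPart_eq (B : Set ℝ) : negPart B = Neg.neg ⁻¹' (B ∩ Set.Iio 0) := by
  ext x
  simp [negPart]

lemma measurableSet_negPart {B : Set ℝ} (hB : MeasurableSet B) : MeasurableSet (negPart B) :=
  (measurable_neg hB).inter measurableSet_Ioi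

lemma moment_inter_Iio (h : SourceDensity p) (k : ℕ) (B : Set ℝ) :
    moment p k (B ∩ Set.Iio 0) = (-1) ^ k * moment p k (negPart B) := by
  rw [negPart_eq, moment_neg_preimage h, ← mul_assoc, ← mul_pow]
  simp

lemma moment_compl_inter_Iio (h : SourceDensity p) (hi : Integrable p) (k : ℕ) {B : Set ℝ}
    (hB : MeasurableSet B) : moment p k (Bᶜ ∩ Set.Iio 0) =
      (-1) ^ k * (moment p k (Set.Ioi 0) - moment p k (negPart B)) := by
  rw [moment_inter_Iio h, negPart, Set.preimage_compl,
    moment_compl_inter_Ioi h hi k (measurable_neg hB), negPart]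

lemma moment_eq_add_negPart (h : SourceDensity p) (hi : Integrable p) (k : ℕ) {B : Set ℝ}
    (hB : MeasurableSet B) : moment p k B =
      moment p k (B ∩ Set.Ioi 0) + (-1) ^ k * moment p k (negPart B) := by
  rw [← moment_inter_Iio h, moment_inter_add_inter h hi k hB]

lemma moment_zero_compl (h : SourceDensity p) (hi : Integrable p) (h1 : moment p 0 Set.univ = 1)
    {B : Set ℝ} (hB : MeasurableSet B) :
    moment p 0 (Bᶜ ∩ Set.Ioi 0) + moment p 0 (Bᶜ ∩ Set.Iio 0) = 1 - moment p 0 B := by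
  rw [moment_inter_add_inter h hi 0 hB.compl, ← h1, ← moment_add_compl h hi 0 hB]
  ring

/-- The algebra of moving the silent masses `qp`, `qn` of the two half lines towards the origin:
`u`, `w` are their first and `s`, `z` their second absolute moments, before (index `1`) and after
(index `0`). The first-moment terms form a quadratic, so their difference is the sum of the two
endpoint gradients, and these are controlled by the ordering of the conditional means. -/
lemma stage_algebra {κ A C qp qn M M2 u₀ u₁ w₀ w₁ s₀ s₁ z₀ z₁ : ℝ} (hκ0 : 0 ≤ κ) (hκ1 : κ ≤ 1)
    (hA : 0 < A) (hC : 0 < C) (hqp : 0 ≤ qp) (hqn : 0 ≤ qn) (hq : 0 < qp + qn)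
    (hu₀ : 0 ≤ u₀) (hw₀ : 0 ≤ w₀) (hu : u₀ ≤ u₁) (hw : w₀ ≤ w₁)
    (hs : ∀ θ, θ * qp ≤ u₁ + u₀ → θ * (u₁ - u₀) ≤ s₁ - s₀)
    (hz : ∀ θ, θ * qn ≤ w₁ + w₀ → θ * (w₁ - w₀) ≤ z₁ - z₀)
    (hp₁ : (u₁ - w₁) / (qp + qn) ≤ (M - u₁) / A) (hn₁ : -((M - w₁) / C) ≤ (u₁ - w₁) / (qp + qn))
    (hp₀ : (u₀ - w₀) / (qp + qn) ≤ (M - u₀) / A)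
    (hn₀ : -((M - w₀) / C) ≤ (u₀ - w₀) / (qp + qn)) :
    s₀ + z₀ - (u₀ - w₀) ^ 2 / (qp + qn) +
        κ * ((M2 - s₀ - (M - u₀) ^ 2 / A) + (M2 - z₀ - (M - w₀) ^ 2 / C)) ≤
      s₁ + z₁ - (u₁ - w₁) ^ 2 / (qp + qn) +
        κ * ((M2 - s₁ - (M - u₁) ^ 2 / A) + (M2 - z₁ - (M - w₁) ^ 2 / C)) := by
  set q := qp + qn with hqdef
  set a₁ := (u₁ - w₁) / q with ha₁
  set a₀ := (u₀ - w₀) / q with ha₀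
  set b₁ := (M - u₁) / A with hb₁
  set b₀ := (M - u₀) / A with hb₀
  set d₁ := (M - w₁) / C with hd₁
  set d₀ := (M - w₀) / C with hd₀
  have e1 : a₁ * q = u₁ - w₁ := by rw [ha₁]; field_simp
  have e0 : a₀ * q = u₀ - w₀ := by rw [ha₀]; field_simp
  have kq : (u₁ - w₁) ^ 2 / q - (u₀ - w₀) ^ 2 / q = ((u₁ - u₀) - (w₁ - w₀)) * (a₁ + a₀) := by
    rw [ha₁, ha₀]; field_simp; ring
  have kA : (M - u₁) ^ 2 / A - (M - u₀) ^ 2 / A = -((u₁ - u₀) * (b₁ + b₀)) := by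
    rw [hb₁, hb₀]; field_simp; ring
  have kC : (M - w₁) ^ 2 / C - (M - w₀) ^ 2 / C = -((w₁ - w₀) * (d₁ + d₀)) := by
    rw [hd₁, hd₀]; field_simp; ring
  have hsum : (a₁ + a₀) * q = u₁ + u₀ - (w₁ + w₀) := by linarith
  have g1 : (a₁ + a₀) * (u₁ - u₀) ≤ s₁ - s₀ := by
    apply hs
    rcases le_total 0 (a₁ + a₀) with h0 | h0
    · have := mul_le_mul_of_nonneg_left (show qp ≤ q by linarith) h0
      linarith
    · have := mul_nonpos_of_nonpos_of_nonneg h0 hqp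
      linarith
  have g2 : -(a₁ + a₀) * (w₁ - w₀) ≤ z₁ - z₀ := by
    apply hz
    rcases le_total 0 (a₁ + a₀) with h0 | h0
    · have := mul_nonneg h0 hqn
      linarith
    · have := mul_le_mul_of_nonpos_left (show qn ≤ q by linarith) h0
      linarith
  have g3 : (u₁ - u₀) * (a₁ + a₀) ≤ (u₁ - u₀) * (b₁ + b₀) :=
    mul_le_mul_of_nonneg_left (by linarith) (by linarith)
  have g4 : (w₁ - w₀) * (-(a₁ + a₀)) ≤ (w₁ - w₀) * (d₁ + d₀) :=
    mul_le_mul_of_nonneg_left (by linarith) (by linarith)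
  have g5 := mul_le_mul_of_nonneg_left (add_le_add g3 g4) hκ0
  have g6 := mul_le_mul_of_nonneg_left (add_le_add g1 g2) (sub_nonneg.2 hκ1)
  linear_combination g5 + g6 + kq + κ * kA + κ * kC

lemma stageCost_eq (h : SourceDensity p) (hi : Integrable p) (h1 : moment p 0 Set.univ = 1)
    (κ c : ℝ) {B : Set ℝ} (hB : MeasurableSet B) {P N : Set ℝ} (hP : B ∩ Set.Ioi 0 = P)
    (hN : negPart B = N) : stageCost p κ c B =
      moment p 2 P + moment p 2 N -
          (moment p 1 P - moment p 1 N) ^ 2 / (moment p 0 P + moment p 0 N) +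
        κ * ((moment p 2 (Set.Ioi 0) - moment p 2 P -
            (moment p 1 (Set.Ioi 0) - moment p 1 P) ^ 2 / (1 / 2 - moment p 0 P)) +
          (moment p 2 (Set.Ioi 0) - moment p 2 N -
            (moment p 1 (Set.Ioi 0) - moment p 1 N) ^ 2 / (1 / 2 - moment p 0 N))) +
        c * (1 - (moment p 0 P + moment p 0 N)) := by
  subst hP hN
  rw [stageCost, moment_zero_compl h hi h1 hB]
  simp only [scatter, moment_compl_inter_Ioi h hi _ hB, moment_compl_inter_Iio h hi _ hB,
    moment_eq_add_negPart h hi _ hB, moment_zero_Ioi_zero h hi h1]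
  ring

lemma Icc_inter_Ioi {l r : ℝ} (hl : 0 ≤ l) : Set.Icc (-l) r ∩ Set.Ioi 0 = Set.Ioc 0 r := by
  ext x
  simp only [Set.mem_inter_iff, Set.mem_Icc, Set.mem_Ioi, Set.mem_Ioc]
  constructor
  · rintro ⟨⟨_, h2⟩, h3⟩
    exact ⟨h3, h2⟩
  · rintro ⟨h1, h2⟩
    exact ⟨⟨by linarith, h2⟩, h1⟩

lemma negPart_Icc {l r : ℝ} (hr : 0 ≤ r) : negPart (Set.Icc (-l) r) = Set.Ioc 0 l := by
  rw [← Icc_inter_Ioi hr, negPart]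
  simp

lemma moment_Ioc_zero (h : SourceDensity p) (hi : Integrable p) (k : ℕ) {r : ℝ} (hr : 0 ≤ r) :
    moment p k (Set.Ioc 0 r) = moment p k (Set.Ioi 0) - moment p k (Set.Ioi r) := by
  rw [← Set.Ioc_union_Ioi_eq_Ioi hr, moment_union h hi k measurableSet_Ioi
    (Set.Ioc_disjoint_Ioi le_rfl)]
  ring

/-- Replacing a silent set by the interval `[-l, r]` with the same masses on the two half lines
lowers the one-step cost. -/
lemma exists_Icc_stageCost_le (h : SourceDensity p) (hi : Integrable p)
    (h1 : moment p 0 Set.univ = 1) {κ : ℝ} (hκ0 : 0 ≤ κ) (hκ1 : κ ≤ 1) (c : ℝ) {B : Set ℝ}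
    (hB : MeasurableSet B) (hB0 : 0 < moment p 0 B) (hBp : 0 < moment p 0 (Bᶜ ∩ Set.Ioi 0))
    (hBn : 0 < moment p 0 (Bᶜ ∩ Set.Iio 0))
    (hlow : moment p 1 (Bᶜ ∩ Set.Iio 0) / moment p 0 (Bᶜ ∩ Set.Iio 0) ≤
      moment p 1 B / moment p 0 B)
    (hup : moment p 1 B / moment p 0 B ≤
      moment p 1 (Bᶜ ∩ Set.Ioi 0) / moment p 0 (Bᶜ ∩ Set.Ioi 0)) :
    ∃ l r, 0 ≤ l ∧ 0 ≤ r ∧ stageCost p κ c (Set.Icc (-l) r) ≤ stageCost p κ c B := by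
  have hhalf := moment_zero_Ioi_zero h hi h1
  have hP : MeasurableSet (B ∩ Set.Ioi 0) := hB.inter measurableSet_Ioi
  have hN : MeasurableSet (negPart B) := measurableSet_negPart hB
  rw [moment_compl_inter_Ioi h hi 0 hB] at hBp hup
  rw [moment_compl_inter_Iio h hi 0 hB] at hBn hlow
  rw [moment_compl_inter_Ioi h hi 1 hB] at hup
  rw [moment_compl_inter_Iio h hi 1 hB] at hlow
  rw [moment_eq_add_negPart h hi 0 hB] at hB0 hup hlow
  rw [moment_eq_add_negPart h hi 1 hB] at hup hlow
  -- an interval at the origin with the mass of `D`, and how its moments compare with those of `D`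
  have aux : ∀ D : Set ℝ, MeasurableSet D → D ⊆ Set.Ioi 0 →
      moment p 0 D < moment p 0 (Set.Ioi 0) →
      ∃ r, 0 ≤ r ∧ moment p 0 (Set.Ioc 0 r) = moment p 0 D ∧
        0 ≤ moment p 1 (Set.Ioc 0 r) ∧ moment p 1 (Set.Ioc 0 r) ≤ moment p 1 D ∧
        moment p 1 (Set.Ioc 0 r) ≤ r * moment p 0 D ∧
        r * (1 / 2 - moment p 0 D) ≤ moment p 1 (Set.Ioi 0) - moment p 1 (Set.Ioc 0 r) ∧
        ∀ θ, θ * moment p 0 D ≤ moment p 1 D + moment p 1 (Set.Ioc 0 r) →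
          θ * (moment p 1 D - moment p 1 (Set.Ioc 0 r)) ≤
            moment p 2 D - moment p 2 (Set.Ioc 0 r) := by
    intro D hD hDpos hlt
    obtain ⟨r, hr, hrm⟩ := exists_moment_zero_Ioi_eq h hi (sub_pos.2 hlt)
      (sub_le_self _ (moment_zero_nonneg h D))
    have hm : moment p 0 (Set.Ioc 0 r) = moment p 0 D := by
      rw [moment_Ioc_zero h hi 0 hr, hrm]
      ring
    have hfirst := moment_one_Ioc_le h hi hD hDpos hm
    have hscat := scatter_Ioc_le h hi hr hD hDpos hm
    refine ⟨r, hr, hm, moment_one_nonneg h measurableSet_Ioc fun x hx => hx.1.le, hfirst,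
      ?_, ?_, ?_⟩
    · have : ∫ x in Set.Ioc 0 r, (0 * x ^ 2 + 1 * x + -r) * p x ≤ 0 :=
        setIntegral_nonpos measurableSet_Ioc fun x hx =>
          mul_nonpos_of_nonpos_of_nonneg (by linarith [hx.2]) (h.pos x).le
      rw [h.setIntegral_quadratic hi, hm] at this
      linarith
    · have : 0 ≤ ∫ x in Set.Ioi r, (0 * x ^ 2 + 1 * x + -r) * p x :=
        setIntegral_nonneg measurableSet_Ioi fun x hx =>
          mul_nonneg (by have := Set.mem_Ioi.1 hx; linarith) (h.pos x).le
      rw [h.setIntegral_quadratic hi, hrm] at this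
      rw [moment_Ioc_zero h hi 1 hr, ← hhalf]
      linarith
    · intro θ hθ
      rcases (moment_zero_nonneg h D).eq_or_lt with h0 | h0
      · simp [moment_eq_zero_of_moment_zero h hi h0.symm,
          moment_eq_zero_of_moment_zero h hi (hm.trans h0.symm)]
      · unfold scatter at hscat
        rw [hm] at hscat
        have e : (moment p 1 D + moment p 1 (Set.Ioc 0 r)) / moment p 0 D *
            (moment p 1 D - moment p 1 (Set.Ioc 0 r)) =
            moment p 1 D ^ 2 / moment p 0 D - moment p 1 (Set.Ioc 0 r) ^ 2 / moment p 0 D := by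
          field_simp
          ring
        have := mul_le_mul_of_nonneg_right ((le_div_iff₀ h0).2 hθ) (sub_nonneg.2 hfirst)
        linarith
  obtain ⟨r, hr, rm, ru0, ru, rr, rR, rs⟩ := aux _ hP Set.inter_subset_right (by linarith)
  obtain ⟨l, hl, lm, lu0, lu, ll, lL, ls⟩ := aux _ hN Set.inter_subset_right (by linarith)
  refine ⟨l, r, hl, hr, ?_⟩
  rw [stageCost_eq h hi h1 κ c measurableSet_Icc (Icc_inter_Ioi hl) (negPart_Icc hr),
    stageCost_eq h hi h1 κ c hB rfl rfl, rm, lm]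
  simp only [pow_zero, pow_one, one_mul, neg_mul] at hBn hB0 hlow hup
  rw [hhalf] at hBp hBn hlow hup
  have hqp := moment_zero_nonneg h (B ∩ Set.Ioi 0)
  have hqn := moment_zero_nonneg h (negPart B)
  refine add_le_add (stage_algebra hκ0 hκ1 hBp hBn hqp hqn hB0 ru0 lu0 ru lu rs ls ?_ ?_ ?_ ?_)
    le_rfl
  · rwa [sub_eq_add_neg]
  · rwa [sub_eq_add_neg, ← neg_div]
  · rw [div_le_iff₀ hB0]
    have := (le_div_iff₀ hBp).2 rR
    nlinarith
  · have := (le_div_iff₀ hBn).2 lL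
    rw [neg_le, ← neg_div, div_le_iff₀ hB0]
    nlinarith

/-- The one-step cost of the symmetric threshold `b`. -/
def thresholdCost (p : ℝ → ℝ) (κ c b : ℝ) : ℝ := stageCost p κ c (Set.Icc (-b) b)

lemma compl_Icc_inter_Ioi {l r : ℝ} (hl : 0 ≤ l) (hr : 0 ≤ r) :
    (Set.Icc (-l) r)ᶜ ∩ Set.Ioi 0 = Set.Ioi r := by
  ext x
  simp only [Set.mem_inter_iff, Set.mem_compl_iff, Set.mem_Icc, Set.mem_Ioi, not_and, not_le]
  constructor
  · rintro ⟨h1, h2⟩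
    exact h1 (by linarith)
  · intro h1
    exact ⟨fun _ => h1, by linarith⟩

lemma compl_Icc_inter_Iio {l r : ℝ} (hl : 0 ≤ l) (hr : 0 ≤ r) :
    (Set.Icc (-l) r)ᶜ ∩ Set.Iio 0 = Neg.neg ⁻¹' Set.Ioi l := by
  rw [← compl_Icc_inter_Ioi hr hl]
  ext x
  simp only [Set.mem_inter_iff, Set.mem_compl_iff, Set.mem_Icc, Set.mem_Iio, Set.mem_preimage,
    Set.mem_Ioi, not_and, not_le, Left.neg_pos_iff]
  constructor
  · rintro ⟨h1, h2⟩
    refine ⟨fun h3 => ?_, h2⟩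
    by_contra! hcon
    linarith [h1 (by linarith)]
  · rintro ⟨h1, h2⟩
    refine ⟨fun h3 => ?_, h2⟩
    by_contra! hcon
    linarith [h1 (by linarith)]

lemma stageCost_Icc (h : SourceDensity p) (κ c : ℝ) {l r : ℝ} (hl : 0 ≤ l) (hr : 0 ≤ r) :
    stageCost p κ c (Set.Icc (-l) r) = scatter p (Set.Icc (-l) r) +
      κ * (scatter p (Set.Ioi r) + scatter p (Set.Ioi l)) +
      c * (moment p 0 (Set.Ioi r) + moment p 0 (Set.Ioi l)) := by
  rw [stageCost, compl_Icc_inter_Ioi hl hr, compl_Icc_inter_Iio hl hr, scatter_neg_preimage h,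
    moment_neg_preimage h]
  simp

lemma moment_Icc (h : SourceDensity p) (hi : Integrable p) (k : ℕ) {l r : ℝ} (hl : 0 ≤ l)
    (hr : 0 ≤ r) : moment p k (Set.Icc (-l) r) =
      (moment p k (Set.Ioi 0) - moment p k (Set.Ioi r)) +
        (-1) ^ k * (moment p k (Set.Ioi 0) - moment p k (Set.Ioi l)) := by
  rw [moment_eq_add_negPart h hi k measurableSet_Icc, Icc_inter_Ioi hl, negPart_Icc hr,
    moment_Ioc_zero h hi k hl, moment_Ioc_zero h hi k hr]

lemma scatter_Icc_self (h : SourceDensity p) (hi : Integrable p) {b : ℝ} (hb : 0 ≤ b) :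
    scatter p (Set.Icc (-b) b) = 2 * (moment p 2 (Set.Ioi 0) - moment p 2 (Set.Ioi b)) := by
  simp only [scatter, moment_Icc h hi _ hb hb]
  ring

lemma thresholdCost_eq (h : SourceDensity p) (hi : Integrable p) (κ c : ℝ) {b : ℝ}
    (hb : 0 ≤ b) : thresholdCost p κ c b =
      2 * (moment p 2 (Set.Ioi 0) - moment p 2 (Set.Ioi b) + κ * scatter p (Set.Ioi b) +
        c * moment p 0 (Set.Ioi b)) := by
  rw [thresholdCost, stageCost_Icc h κ c hb hb, scatter_Icc_self h hi hb]
  ring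

/-- `b` balances the squared error of silence at the boundary against the cost of transmitting. -/
def IsBalanced (p : ℝ → ℝ) (κ c b : ℝ) : Prop :=
  0 ≤ b ∧ b ^ 2 = κ * meanResidual p b ^ 2 + c

/-- Among silent intervals `[-l, r]` the balanced centred one is the cheapest. The transmission
terms are compared by the monotone mean residual life, and what remains is the problem of
catching `b² - x²` with a translate of a centred kernel. -/
lemma thresholdCost_le_stageCost_Icc (h : SourceDensity p) (hi : Integrable p)
    (h1 : moment p 0 Set.univ = 1) {κ c b : ℝ} (hκ0 : 0 ≤ κ) (hb : IsBalanced p κ c b)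
    {l r : ℝ} (hl : 0 ≤ l) (hr : 0 ≤ r) :
    thresholdCost p κ c b ≤ stageCost p κ c (Set.Icc (-l) r) := by
  obtain ⟨hb0, hbal⟩ := hb
  have hhalf := moment_zero_Ioi_zero h hi h1
  have t1 := mul_le_mul_of_nonneg_left (scatter_Ioi_sub_le h hi b r) hκ0
  have t2 := mul_le_mul_of_nonneg_left (scatter_Ioi_sub_le h hi b l) hκ0
  have t3 := moment_Icc_le_scatter h hi hb0 (measurableSet_Icc (a := -l) (b := r))
  rw [thresholdCost_eq h hi κ c hb0, stageCost_Icc h κ c hl hr]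
  rw [moment_Icc h hi 0 hl hr, moment_Icc h hi 2 hb0 hb0, moment_Icc h hi 0 hb0 hb0, hhalf] at t3
  have hc : c = b ^ 2 - κ * meanResidual p b ^ 2 := by linarith
  subst hc
  linarith

/-- The balanced symmetric threshold is the cheapest among all silent sets whose mean lies between
the means of the two transmitted half lines. -/
theorem thresholdCost_le_stageCost (h : SourceDensity p) (hi : Integrable p)
    (h1 : moment p 0 Set.univ = 1) {κ c b : ℝ} (hκ0 : 0 ≤ κ) (hκ1 : κ ≤ 1)
    (hb : IsBalanced p κ c b) {B : Set ℝ}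
    (hB : MeasurableSet B) (hB0 : 0 < moment p 0 B) (hBp : 0 < moment p 0 (Bᶜ ∩ Set.Ioi 0))
    (hBn : 0 < moment p 0 (Bᶜ ∩ Set.Iio 0))
    (hlow : moment p 1 (Bᶜ ∩ Set.Iio 0) / moment p 0 (Bᶜ ∩ Set.Iio 0) ≤
      moment p 1 B / moment p 0 B)
    (hup : moment p 1 B / moment p 0 B ≤
      moment p 1 (Bᶜ ∩ Set.Ioi 0) / moment p 0 (Bᶜ ∩ Set.Ioi 0)) :
    thresholdCost p κ c b ≤ stageCost p κ c B := by
  obtain ⟨l, r, hl, hr, hle⟩ :=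
    exists_Icc_stageCost_le h hi h1 hκ0 hκ1 c hB hB0 hBp hBn hlow hup
  exact (thresholdCost_le_stageCost_Icc h hi h1 hκ0 hb hl hr).trans hle

lemma thresholdCost_lt (h : SourceDensity p) (hi : Integrable p) {κ c b r : ℝ} (hκ0 : 0 ≤ κ)
    (hb : IsBalanced p κ c b) (hr : 0 ≤ r) (hne : r ≠ b) :
    thresholdCost p κ c b < thresholdCost p κ c r := by
  obtain ⟨hb0, hbal⟩ := hb
  have t1 := mul_le_mul_of_nonneg_left (scatter_Ioi_sub_le h hi b r) hκ0
  -- the silent part contributes `∫ (x² - b²)` between the two thresholds, which is positive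
  have t2 : 0 < (moment p 2 (Set.Ioi b) - b ^ 2 * moment p 0 (Set.Ioi b)) -
      (moment p 2 (Set.Ioi r) - b ^ 2 * moment p 0 (Set.Ioi r)) := by
    set D : ℝ → ℝ := fun x => moment p 2 (Set.Ioi x) - b ^ 2 * moment p 0 (Set.Ioi x) with hD
    have hder : ∀ x, HasDerivAt D (p x * (b ^ 2 - x ^ 2)) x := fun x =>
      ((hasDerivAt_moment_Ioi h hi 2 x).sub
        ((hasDerivAt_moment_Ioi h hi 0 x).const_mul (b ^ 2))).congr_deriv (by ring)
    have hcont : Continuous D := continuous_iff_continuousAt.2 fun x => (hder x).continuousAt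
    suffices D r < D b by
      simp only [hD] at this
      linarith
    rcases lt_or_gt_of_ne hne with hlt | hlt
    · refine strictMonoOn_of_deriv_pos (convex_Icc r b) hcont.continuousOn ?_
        (Set.left_mem_Icc.2 hlt.le) (Set.right_mem_Icc.2 hlt.le) hlt
      intro x hx
      rw [interior_Icc] at hx
      rw [(hder x).deriv]
      exact mul_pos (h.pos x) (by nlinarith [hx.1, hx.2])
    · refine strictAntiOn_of_deriv_neg (convex_Icc b r) hcont.continuousOn ?_
        (Set.left_mem_Icc.2 hlt.le) (Set.right_mem_Icc.2 hlt.le) hlt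
      intro x hx
      rw [interior_Icc] at hx
      rw [(hder x).deriv]
      exact mul_neg_of_pos_of_neg (h.pos x) (by nlinarith [hx.1, hx.2])
  rw [thresholdCost_eq h hi κ c hb0, thresholdCost_eq h hi κ c hr]
  have hc : c = b ^ 2 - κ * meanResidual p b ^ 2 := by linarith
  subst hc
  linarith

lemma thresholdCost_le (h : SourceDensity p) (hi : Integrable p) {κ c b r : ℝ} (hκ0 : 0 ≤ κ)
    (hb : IsBalanced p κ c b) (hr : 0 ≤ r) : thresholdCost p κ c b ≤ thresholdCost p κ c r := by
  rcases eq_or_ne r b with rfl | hne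
  · exact le_rfl
  · exact (thresholdCost_lt h hi hκ0 hb hr hne).le

lemma IsBalanced.pos (h : SourceDensity p) (hi : Integrable p) {κ c b : ℝ} (hκ0 : 0 < κ)
    (hc : 0 ≤ c) (hb : IsBalanced p κ c b) : 0 < b := by
  refine lt_of_le_of_ne hb.1 fun h0 => ?_
  have h2 := hb.2
  rw [← h0] at h2
  have := mul_pos hκ0 (pow_pos (meanResidual_pos h hi 0) 2)
  linarith

/-- The balance equation has exactly one solution, as `b² - κ E[X - b | X > b]²` increases
strictly from a negative value to infinity. -/
lemma existsUnique_isBalanced (h : SourceDensity p) (hi : Integrable p) {κ c : ℝ} (hκ0 : 0 ≤ κ)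
    (hc : 0 ≤ c) : ∃! b, IsBalanced p κ c b := by
  set g : ℝ → ℝ := fun b => b ^ 2 - κ * meanResidual p b ^ 2 with hg
  have hcont : Continuous g := by
    have := continuous_meanResidual h hi
    fun_prop
  have hres : ∀ {x y}, x ≤ y → meanResidual p y ^ 2 ≤ meanResidual p x ^ 2 := fun {x y} hxy =>
    pow_le_pow_left₀ (meanResidual_pos h hi y).le (meanResidual_antitone h hi hxy) 2
  have hmono : StrictMonoOn g (Set.Ici 0) := by
    intro x hx y hy hxy
    have := mul_le_mul_of_nonneg_left (hres hxy.le) hκ0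
    have h2 : x ^ 2 < y ^ 2 := pow_lt_pow_left₀ hxy hx two_ne_zero
    simp only [hg]
    linarith
  set R := Real.sqrt (κ * meanResidual p 0 ^ 2 + c) with hR
  have hR0 : 0 ≤ R := Real.sqrt_nonneg _
  have hRsq : R ^ 2 = κ * meanResidual p 0 ^ 2 + c := Real.sq_sqrt (by positivity)
  have hlow : g 0 ≤ c := by
    have : 0 ≤ κ * meanResidual p 0 ^ 2 := by positivity
    simp only [hg]
    linarith
  have hhigh : c ≤ g R := by
    have := mul_le_mul_of_nonneg_left (hres hR0) hκ0
    simp only [hg]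
    linarith
  obtain ⟨b, hb, hbc⟩ := intermediate_value_Icc hR0 hcont.continuousOn ⟨hlow, hhigh⟩
  refine ⟨b, ⟨hb.1, by simp only [hg] at hbc; linarith⟩, fun y hy => ?_⟩
  refine hmono.injOn hy.1 hb.1 ?_
  have := hy.2
  simp only [hg] at hbc ⊢
  linarith

/-- The optimal one-step cost increases with the price of a transmission, at a rate at most `1`. -/
lemma thresholdCost_mono (h : SourceDensity p) (hi : Integrable p) {κ c c' b b' : ℝ}
    (hκ0 : 0 ≤ κ) (hcc : c ≤ c') (hb : IsBalanced p κ c b) (hb' : IsBalanced p κ c' b') :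
    thresholdCost p κ c b ≤ thresholdCost p κ c' b' := by
  refine (thresholdCost_le h hi hκ0 hb hb'.1).trans ?_
  rw [thresholdCost_eq h hi κ c hb'.1, thresholdCost_eq h hi κ c' hb'.1]
  have := mul_le_mul_of_nonneg_right hcc (moment_zero_nonneg h (Set.Ioi b'))
  linarith

lemma thresholdCost_lipschitz (h : SourceDensity p) (hi : Integrable p)
    (h1 : moment p 0 Set.univ = 1) {κ c c' b b' : ℝ}
    (hκ0 : 0 ≤ κ) (hcc : c ≤ c') (hb : IsBalanced p κ c b) (hb' : IsBalanced p κ c' b') :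
    thresholdCost p κ c' b' ≤ thresholdCost p κ c b + (c' - c) := by
  refine (thresholdCost_le h hi hκ0 hb' hb.1).trans ?_
  rw [thresholdCost_eq h hi κ c' hb.1, thresholdCost_eq h hi κ c hb.1]
  have hQ : moment p 0 (Set.Ioi b) ≤ 1 / 2 := by
    have := moment_zero_nonneg h (Set.Ioc 0 b)
    rw [moment_Ioc_zero h hi 0 hb.1, moment_zero_Ioi_zero h hi h1] at this
    linarith
  nlinarith [mul_le_mul_of_nonneg_left hQ (sub_nonneg.2 hcc)]

/-- With an optimal threshold, a step costs at most as much as permanent silence: a threshold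
`r ≥ √c` already achieves this, as both errors on the tail are then dominated. -/
lemma thresholdCost_le_scatter_univ (h : SourceDensity p) (hi : Integrable p) {κ c b : ℝ}
    (hκ0 : 0 ≤ κ) (hκ1 : κ ≤ 1) (hc : 0 ≤ c) (hb : IsBalanced p κ c b) :
    thresholdCost p κ c b ≤ scatter p Set.univ := by
  set r := Real.sqrt c with hr
  have hr0 : 0 ≤ r := Real.sqrt_nonneg c
  have hrc : r ^ 2 = c := Real.sq_sqrt hc
  refine (thresholdCost_le h hi hκ0 hb hr0).trans ?_
  have hQ := moment_zero_Ioi_pos h hi r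
  have hL : r * moment p 0 (Set.Ioi r) ≤ moment p 1 (Set.Ioi r) := by
    have := (meanResidual_pos h hi r).le
    rw [meanResidual, sub_nonneg, le_div_iff₀ hQ] at this
    exact this
  have hS : r ^ 2 * moment p 0 (Set.Ioi r) ≤ moment p 2 (Set.Ioi r) := by
    have : 0 ≤ ∫ x in Set.Ioi r, (1 * x ^ 2 + 0 * x + -r ^ 2) * p x :=
      setIntegral_nonneg measurableSet_Ioi fun x hx =>
        mul_nonneg (by have := Set.mem_Ioi.1 hx; nlinarith) (h.pos x).le
    rw [h.setIntegral_quadratic hi] at this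
    linarith
  have hV : scatter p (Set.Ioi r) ≤ moment p 2 (Set.Ioi r) - r ^ 2 * moment p 0 (Set.Ioi r) := by
    have : r ^ 2 * moment p 0 (Set.Ioi r) ≤
        moment p 1 (Set.Ioi r) ^ 2 / moment p 0 (Set.Ioi r) := by
      rw [le_div_iff₀ hQ]
      have := pow_le_pow_left₀ (by positivity) hL 2
      linarith
    unfold scatter
    linarith
  have hone : moment p 1 Set.univ = 0 := by
    have := moment_neg_preimage h 1 Set.univ
    simp only [Set.preimage_univ, pow_one] at this
    linarith
  have htwo : moment p 2 Set.univ = 2 * moment p 2 (Set.Ioi 0) := by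
    have e := moment_inter_add_inter h hi 2 MeasurableSet.univ
    have e2 := moment_neg_preimage h 2 (Set.Ioi 0)
    rw [Set.univ_inter, Set.univ_inter] at e
    simp only [Set.neg_preimage, Set.neg_Ioi, neg_zero] at e2
    linarith
  have hU : scatter p Set.univ = 2 * moment p 2 (Set.Ioi 0) := by simp [scatter, hone, htwo]
  rw [thresholdCost_eq h hi κ c hr0, hU, ← hrc]
  have h1 := mul_le_mul_of_nonneg_left hV hκ0
  have h2 := mul_le_mul_of_nonneg_left hS (sub_nonneg.2 hκ1)
  linarith

namespace Model

variable {Ω : Type*} [MeasurableSpace Ω] {M : Model Ω} {pX : ℝ → ℝ}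

/-! ### The law of the source -/

lemma IsIIDSource.lintegral_eq_one (hX : M.IsIIDSource pX) {t : ℕ} (ht : t ∈ Set.Icc 1 M.T) :
    ∫⁻ x, ENNReal.ofReal (pX x) = 1 := by
  have := hX.isProb
  have h1 : M.P.map (M.X t) Set.univ = 1 := by
    rw [Measure.map_apply (hX.measurable_X t ht) MeasurableSet.univ, Set.preimage_univ,
      measure_univ]
  rw [hX.law t ht, withDensity_apply _ MeasurableSet.univ, Measure.restrict_univ] at h1
  exact h1

lemma IsIIDSource.integrable_density (hp : SourceDensity pX) (hX : M.IsIIDSource pX) {t : ℕ}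
    (ht : t ∈ Set.Icc 1 M.T) : Integrable pX := by
  refine ⟨hp.continuous.aestronglyMeasurable, ?_⟩
  rw [hasFiniteIntegral_iff_ofReal (Filter.Eventually.of_forall fun x => (hp.pos x).le),
    hX.lintegral_eq_one ht]
  exact ENNReal.one_lt_top

lemma IsIIDSource.moment_zero_univ (hp : SourceDensity pX) (hX : M.IsIIDSource pX) {t : ℕ}
    (ht : t ∈ Set.Icc 1 M.T) : moment pX 0 Set.univ = 1 := by
  simp only [moment, pow_zero, one_mul, Measure.restrict_univ]
  rw [integral_eq_lintegral_of_nonneg_ae (Filter.Eventually.of_forall fun x => (hp.pos x).le)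
    hp.continuous.aestronglyMeasurable, hX.lintegral_eq_one ht, ENNReal.toReal_one]

lemma IsIIDSource.setIntegral_comp (hp : SourceDensity pX) (hX : M.IsIIDSource pX) {t : ℕ}
    (ht : t ∈ Set.Icc 1 M.T) {g : ℝ → ℝ} (hg : Measurable g) {A : Set ℝ} (hA : MeasurableSet A) :
    ∫ ω in M.X t ⁻¹' A, g (M.X t ω) ∂M.P = ∫ x in A, g x * pX x := by
  rw [← setIntegral_map hA hg.aestronglyMeasurable (hX.measurable_X t ht).aemeasurable,
    hX.law t ht, setIntegral_withDensity_eq_setIntegral_toReal_smul _ _ _ hA]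
  · refine integral_congr_ae (Filter.Eventually.of_forall fun x => ?_)
    simp only [smul_eq_mul, ENNReal.toReal_ofReal (hp.pos x).le]
    ring
  · exact hp.continuous.measurable.ennreal_ofReal
  · exact Filter.Eventually.of_forall fun x => ENNReal.ofReal_lt_top

lemma IsIIDSource.setIntegral_pow (hp : SourceDensity pX) (hX : M.IsIIDSource pX) {t : ℕ}
    (ht : t ∈ Set.Icc 1 M.T) (k : ℕ) {A : Set ℝ} (hA : MeasurableSet A) :
    ∫ ω in M.X t ⁻¹' A, M.X t ω ^ k ∂M.P = moment pX k A :=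
  hX.setIntegral_comp hp ht (measurable_id.pow_const k) hA

lemma IsIIDSource.real_preimage (hp : SourceDensity pX) (hX : M.IsIIDSource pX) {t : ℕ}
    (ht : t ∈ Set.Icc 1 M.T) {A : Set ℝ} (hA : MeasurableSet A) :
    M.P.real (M.X t ⁻¹' A) = moment pX 0 A := by
  rw [← hX.setIntegral_pow hp ht 0 hA]
  simp

lemma IsIIDSource.measure_pos_iff (hp : SourceDensity pX) (hX : M.IsIIDSource pX) {t : ℕ}
    (ht : t ∈ Set.Icc 1 M.T) {A : Set ℝ} (hA : MeasurableSet A) :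
    0 < M.P (M.X t ⁻¹' A) ↔ 0 < moment pX 0 A := by
  have := hX.isProb
  rw [← hX.real_preimage hp ht hA, measureReal_def, ENNReal.toReal_pos_iff]
  simp

lemma integral_cond (P : Measure Ω) (E : Set Ω) (g : Ω → ℝ) :
    ∫ ω, g ω ∂(P[|E]) = (P.real E)⁻¹ * ∫ ω in E, g ω ∂P := by
  rw [ProbabilityTheory.cond, integral_smul_measure, ENNReal.toReal_inv, smul_eq_mul,
    measureReal_def]

lemma IsIIDSource.condMean_preimage (hp : SourceDensity pX) (hX : M.IsIIDSource pX) {t : ℕ}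
    (ht : t ∈ Set.Icc 1 M.T) {A : Set ℝ} (hA : MeasurableSet A) :
    M.condMean t (M.X t ⁻¹' A) = moment pX 1 A / moment pX 0 A := by
  have := hX.setIntegral_pow hp ht 1 hA
  simp only [pow_one] at this
  rw [condMean, integral_cond, this, hX.real_preimage hp ht hA, div_eq_inv_mul]

lemma setIntegral_sub_mean_sq (hp : SourceDensity pX) (hi : Integrable pX) (A : Set ℝ) :
    ∫ x in A, (x - moment pX 1 A / moment pX 0 A) ^ 2 * pX x = scatter pX A := by
  set m := moment pX 1 A / moment pX 0 A with hm
  have : ∀ x, (x - m) ^ 2 * pX x = (1 * x ^ 2 + -(2 * m) * x + m ^ 2) * pX x := fun x => by ring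
  simp only [this]
  rw [hp.setIntegral_quadratic hi, scatter]
  rcases eq_or_ne (moment pX 0 A) 0 with h0 | h0
  · simp [hm, h0]
  · rw [hm]
    field_simp
    ring

lemma setIntegral_sub_mean (hp : SourceDensity pX) (hi : Integrable pX) (A : Set ℝ) :
    ∫ x in A, (x - moment pX 1 A / moment pX 0 A) * pX x = 0 := by
  set m := moment pX 1 A / moment pX 0 A with hm
  have : ∀ x, (x - m) * pX x = (0 * x ^ 2 + 1 * x + -m) * pX x := fun x => by ring
  simp only [this]
  rw [hp.setIntegral_quadratic hi]
  rcases eq_or_ne (moment pX 0 A) 0 with h0 | h0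
  · simp [h0, moment_eq_zero_of_moment_zero hp hi h0]
  · rw [hm]
    field_simp
    ring

lemma scatter_nonneg (hp : SourceDensity pX) (hi : Integrable pX) (A : Set ℝ) :
    0 ≤ scatter pX A := by
  rw [← setIntegral_sub_mean_sq hp hi]
  exact integral_nonneg fun x => mul_nonneg (sq_nonneg _) (hp.pos x).le

lemma IsIIDSource.setIntegral_sub_condMean_sq (hp : SourceDensity pX) (hX : M.IsIIDSource pX)
    {t : ℕ} (ht : t ∈ Set.Icc 1 M.T) {A : Set ℝ} (hA : MeasurableSet A) :
    ∫ ω in M.X t ⁻¹' A, (M.X t ω - M.condMean t (M.X t ⁻¹' A)) ^ 2 ∂M.P = scatter pX A := by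
  rw [hX.condMean_preimage hp ht hA, hX.setIntegral_comp hp ht
    (g := fun x => (x - moment pX 1 A / moment pX 0 A) ^ 2) (by fun_prop) hA,
    setIntegral_sub_mean_sq hp (hX.integrable_density hp ht)]

lemma IsIIDSource.setIntegral_sub_condMean (hp : SourceDensity pX) (hX : M.IsIIDSource pX)
    {t : ℕ} (ht : t ∈ Set.Icc 1 M.T) {A : Set ℝ} (hA : MeasurableSet A) :
    ∫ ω in M.X t ⁻¹' A, (M.X t ω - M.condMean t (M.X t ⁻¹' A)) ∂M.P = 0 := by
  rw [hX.condMean_preimage hp ht hA, hX.setIntegral_comp hp ht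
    (g := fun x => x - moment pX 1 A / moment pX 0 A) (by fun_prop) hA,
    setIntegral_sub_mean hp (hX.integrable_density hp ht)]

lemma IsIIDSource.condVar_preimage (hp : SourceDensity pX) (hX : M.IsIIDSource pX) {t : ℕ}
    (ht : t ∈ Set.Icc 1 M.T) {A : Set ℝ} (hA : MeasurableSet A) :
    M.condVar t (M.X t ⁻¹' A) = scatter pX A / moment pX 0 A := by
  rw [condVar, variance_eq_integral (hX.measurable_X t ht).aemeasurable, integral_cond,
    ← hX.setIntegral_sub_condMean_sq hp ht hA, hX.real_preimage hp ht hA, div_eq_inv_mul]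
  rfl

lemma IsIIDSource.memLp_X (hp : SourceDensity pX) (hX : M.IsIIDSource pX) {t : ℕ}
    (ht : t ∈ Set.Icc 1 M.T) : MemLp (M.X t) 2 M.P := by
  rw [memLp_two_iff_integrable_sq (hX.measurable_X t ht).aestronglyMeasurable]
  have hi := hp.integrable_pow_mul (hX.integrable_density hp ht) 2
  have : Integrable (fun x : ℝ => x ^ 2) (M.P.map (M.X t)) := by
    rw [hX.law t ht, integrable_withDensity_iff hp.continuous.measurable.ennreal_ofReal
      (Filter.Eventually.of_forall fun x => ENNReal.ofReal_lt_top)]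
    refine hi.congr (Filter.Eventually.of_forall fun x => ?_)
    simp only [ENNReal.toReal_ofReal (hp.pos x).le]
  exact (integrable_map_measure (by fun_prop) (hX.measurable_X t ht).aemeasurable).1 this

/-! ### The expected cost of one step -/

/-- The set of observations on which `f` is silent. -/
def silentSet (f : Strategy) (t e : ℕ) : Set ℝ := {x | f t x e = false}

lemma measurableSet_silentSet {f : Strategy} {t e : ℕ} (hf : Measurable fun x => f t x e) :
    MeasurableSet (silentSet f t e) := hf (measurableSet_singleton false)

lemma silent_eq (f : Strategy) (t e : ℕ) : M.silent f t e = M.X t ⁻¹' silentSet f t e := rfl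

lemma sent_one_eq (f : Strategy) (t e : ℕ) :
    M.sent f t e 1 = M.X t ⁻¹' ((silentSet f t e)ᶜ ∩ Set.Ioi 0) := by
  ext ω
  simp [sent, silentSet, sign_eq_one_iff]

lemma sent_neg_one_eq (f : Strategy) (t e : ℕ) :
    M.sent f t e (-1) = M.X t ⁻¹' ((silentSet f t e)ᶜ ∩ Set.Iio 0) := by
  ext ω
  simp [sent, silentSet, sign_eq_neg_one_iff]

/-- The estimate, as a function of the values of the source and of the noise. -/
def estimateFun (M : Model Ω) (f : Strategy) (t e : ℕ) (z : ℝ × ℝ) : ℝ :=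
  if f t z.1 e then
    (SignType.sign z.1 : ℝ) * (1 / M.gain f t e (SignType.sign z.1)) * (M.snr / (M.snr + 1)) *
      ((SignType.sign z.1 : ℝ) * M.gain f t e (SignType.sign z.1) *
        (z.1 - M.condMean t (M.sent f t e (SignType.sign z.1))) + z.2) +
      M.condMean t (M.sent f t e (SignType.sign z.1))
  else M.condMean t (M.silent f t e)

lemma estimate_eq (f : Strategy) (t e : ℕ) (ω : Ω) :
    M.estimate f t e ω = M.estimateFun f t e (M.X t ω, M.V t ω) := by
  unfold estimate estimateFun channelOut sideMsg sensorMsg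
  by_cases h : f t (M.X t ω) e = true <;> simp [h, decoder, encoder]

lemma measurable_estimateFun {f : Strategy} {t e : ℕ} (hf : Measurable fun x => f t x e) :
    Measurable (M.estimateFun f t e) := by
  have hsgn : ∀ F : SignType → ℝ × ℝ → ℝ, (∀ s, Measurable (F s)) →
      Measurable fun z : ℝ × ℝ => F (SignType.sign z.1) z := by
    intro F hF
    have : (fun z : ℝ × ℝ => F (SignType.sign z.1) z) =
        fun z => if 0 < z.1 then F 1 z else if z.1 < 0 then F (-1) z else F 0 z := by
      ext z
      rcases lt_trichotomy z.1 0 with hz | hz | hz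
      · simp [hz, hz.not_gt]
      · simp [hz]
      · simp [hz]
    rw [this]
    exact Measurable.ite (measurableSet_lt measurable_const measurable_fst) (hF 1)
      (Measurable.ite (measurableSet_lt measurable_fst measurable_const) (hF (-1)) (hF 0))
  refine Measurable.ite ((hf.comp measurable_fst) (measurableSet_singleton true)) ?_
    measurable_const
  exact hsgn (fun s z => (s : ℝ) * (1 / M.gain f t e s) * (M.snr / (M.snr + 1)) *
      ((s : ℝ) * M.gain f t e s * (z.1 - M.condMean t (M.sent f t e s)) + z.2) +
      M.condMean t (M.sent f t e s)) fun s => by fun_prop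

/-- On an event of the source with a fixed sign, the noise and the source are uncorrelated, with
the conditional moments of the noise given the sign. -/
lemma setIntegral_mul_noise (hX : M.IsIIDSource pX)
    (hV : M.ChannelNoise) {t : ℕ} (ht : t ∈ Set.Icc 1 M.T) {s : SignType} {A : Set ℝ}
    (hA : MeasurableSet A) (hAs : ∀ x ∈ A, SignType.sign x = s)
    (hE0 : M.P.real (M.signEvent t s) ≠ 0)
    {g k : ℝ → ℝ} (hg : Measurable g) (hk : Measurable k) :
    ∫ ω in M.X t ⁻¹' A, g (M.X t ω) * k (M.V t ω) ∂M.P =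
      (∫ ω in M.X t ⁻¹' A, g (M.X t ω) ∂M.P) * ∫ ω, k (M.V t ω) ∂(M.P[|M.signEvent t s]) := by
  have hXm := hX.measurable_X t ht
  have hsub : M.X t ⁻¹' A ⊆ M.signEvent t s := fun ω hω => hAs _ hω
  have hres : ∀ φ : Ω → ℝ, ∫ ω in M.X t ⁻¹' A, φ ω ∂M.P =
      ∫ ω in M.signEvent t s, (M.X t ⁻¹' A).indicator φ ω ∂M.P := fun φ => by
    rw [setIntegral_indicator (hXm hA), Set.inter_eq_self_of_subset_right hsub]
  have hind := (hV.condIndep t ht s).symm.integral_fun_comp_mul_comp (f := A.indicator g) (g := k)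
    hXm.aemeasurable (hX.measurable_V t ht).aemeasurable
    (hg.indicator hA).aestronglyMeasurable hk.aestronglyMeasurable
  rw [integral_cond, integral_cond (g := fun ω => A.indicator g (M.X t ω))] at hind
  have e1 : ∀ ω, A.indicator g (M.X t ω) * k (M.V t ω) =
      (M.X t ⁻¹' A).indicator (fun ω => g (M.X t ω) * k (M.V t ω)) ω := fun ω => by
    by_cases h : M.X t ω ∈ A <;> simp [h]
  have e2 : ∀ ω, A.indicator g (M.X t ω) =
      (M.X t ⁻¹' A).indicator (fun ω => g (M.X t ω)) ω := fun ω => by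
    by_cases h : M.X t ω ∈ A <;> simp [h]
  simp only [e1] at hind
  simp only [e2] at hind
  rw [hres, hres]
  rw [mul_assoc] at hind
  exact mul_left_cancel₀ (inv_ne_zero hE0) hind

/-- The error of a transmission on the event `X ∈ A` of fixed sign `s`: after the linear decoder
the fraction `1 / (γ + 1)` of the conditional variance remains. -/
lemma setIntegral_sent_sq (hp : SourceDensity pX) (hX : M.IsIIDSource pX)
    (hV : M.ChannelNoise) (hP : 0 < M.power) {t : ℕ} (ht : t ∈ Set.Icc 1 M.T) {s : SignType}
    (hs : s ≠ 0) {A : Set ℝ} (hA : MeasurableSet A) (hAs : ∀ x ∈ A, SignType.sign x = s)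
    (hE0 : M.P.real (M.signEvent t s) ≠ 0)
    {f : Strategy} {e : ℕ} (hf : ∀ x ∈ A, f t x e = true)
    (hsent : M.sent f t e s = M.X t ⁻¹' A) :
    IntegrableOn (fun ω => (M.X t ω - M.estimate f t e ω) ^ 2) (M.X t ⁻¹' A) M.P ∧
    ∫ ω in M.X t ⁻¹' A, (M.X t ω - M.estimate f t e ω) ^ 2 ∂M.P =
      1 / (M.snr + 1) * scatter pX A := by
  have := hX.isProb
  have hi := hX.integrable_density hp ht
  set m := M.condMean t (M.X t ⁻¹' A) with hm
  set α := M.gain f t e s with hα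
  set g := M.snr / (M.snr + 1) with hg
  set a := 1 - 1 / α * α * g with ha
  set b := (s : ℝ) * (1 / α) * g with hb
  have hs2 : (s : ℝ) * s = 1 := by
    cases s <;> simp_all
  have hXA := (hX.measurable_X t ht) hA
  have heq : ∀ ω ∈ M.X t ⁻¹' A, (M.X t ω - M.estimate f t e ω) ^ 2 =
      (a * (M.X t ω - m) - b * M.V t ω) ^ 2 := by
    intro ω hω
    rw [estimate_eq, estimateFun]
    simp only [hf _ hω, if_true, hAs _ hω, hsent]
    rw [← hm, ← hα, ← hg, ha, hb]
    congr 1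
    linear_combination (-(1 / α * α * g * (M.X t ω - m))) * hs2
  have hXL := hX.memLp_X hp ht
  have hVL := hV.memLp t ht
  have hXm : MemLp (fun ω => M.X t ω - m) 2 M.P := hXL.sub (memLp_const m)
  have hL : MemLp (fun ω => a * (M.X t ω - m) - b * M.V t ω) 2 M.P :=
    (hXm.const_mul a).sub (hVL.const_mul b)
  have i1 := hXm.integrable_sq.integrableOn (s := M.X t ⁻¹' A)
  have i2 := (hXm.integrable_mul hVL).integrableOn (s := M.X t ⁻¹' A)
  have i3 := hVL.integrable_sq.integrableOn (s := M.X t ⁻¹' A)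
  refine ⟨(integrableOn_congr_fun heq hXA).2 hL.integrable_sq.integrableOn, ?_⟩
  rw [setIntegral_congr_fun hXA heq]
  have hexp : ∫ ω in M.X t ⁻¹' A, (a * (M.X t ω - m) - b * M.V t ω) ^ 2 ∂M.P =
      a ^ 2 * (∫ ω in M.X t ⁻¹' A, (M.X t ω - m) ^ 2 ∂M.P) -
        2 * a * b * (∫ ω in M.X t ⁻¹' A, (M.X t ω - m) * M.V t ω ∂M.P) +
        b ^ 2 * ∫ ω in M.X t ⁻¹' A, M.V t ω ^ 2 ∂M.P := by
    rw [← integral_const_mul, ← integral_const_mul, ← integral_const_mul]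
    have j1 := integral_sub (i1.const_mul (a ^ 2)) (i2.const_mul (2 * a * b))
    have j2 := integral_add ((i1.const_mul (a ^ 2)).sub (i2.const_mul (2 * a * b)))
      (i3.const_mul (b ^ 2))
    simp only [Pi.sub_apply, Pi.mul_apply] at j1 j2
    rw [← j1, ← j2]
    congr 1
    ext ω
    ring
  have hcross : ∫ ω in M.X t ⁻¹' A, (M.X t ω - m) * M.V t ω ∂M.P = 0 := by
    have := setIntegral_mul_noise hX hV ht hA hAs hE0 (g := fun x => x - m)
      (k := fun v => v) (by fun_prop) (by fun_prop)
    rw [this, hX.setIntegral_sub_condMean hp ht hA, zero_mul]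
  have hnoise : ∫ ω in M.X t ⁻¹' A, M.V t ω ^ 2 ∂M.P = moment pX 0 A * M.noiseVar := by
    have := setIntegral_mul_noise hX hV ht hA hAs hE0 (g := fun x => x ^ 0)
      (k := fun v => v ^ 2) (by fun_prop) (by fun_prop)
    rw [hV.condPower t ht s hs, hX.setIntegral_pow hp ht 0 hA] at this
    simpa using this
  rw [hexp, hcross, hnoise, hX.setIntegral_sub_condMean_sq hp ht hA]
  have hσ := hV.var_pos
  have hγ : 0 < M.snr := div_pos hP hσ
  have hsc := scatter_nonneg hp hi A
  rcases (moment_zero_nonneg hp A).eq_or_lt with h0 | h0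
  · simp [scatter, moment_eq_zero_of_moment_zero hp hi h0.symm]
  have hα2 : (1 / α) ^ 2 = scatter pX A / moment pX 0 A / M.power := by
    rw [hα, gain, hsent, hX.condVar_preimage hp ht hA, one_div, inv_pow, Real.sq_sqrt, inv_div]
    positivity
  rcases hsc.eq_or_lt with hz | hz
  · have : b ^ 2 = 0 := by
      have : b ^ 2 = (s * s : ℝ) * (1 / α) ^ 2 * g ^ 2 := by rw [hb]; ring
      rw [this, hα2, ← hz]
      simp
    rw [← hz, this]
    simp
  · have hα0 : α ≠ 0 := by
      intro h
      rw [h] at hα2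
      have : 0 < scatter pX A / moment pX 0 A / M.power := by positivity
      rw [← hα2] at this
      simp at this
    have ha' : a = 1 / (M.snr + 1) := by
      rw [ha, hg]
      field_simp
      ring
    have hb2 : b ^ 2 = scatter pX A / moment pX 0 A / M.power * g ^ 2 := by
      have : b ^ 2 = (s * s : ℝ) * (1 / α) ^ 2 * g ^ 2 := by rw [hb]; ring
      rw [this, hα2, hs2, one_mul]
    have hpow : M.power = M.snr * M.noiseVar := by
      rw [snr]
      field_simp
    rw [ha', hb2, hg, hpow]
    field_simp
    ring

lemma signEvent_one_eq (t : ℕ) : M.signEvent t 1 = M.X t ⁻¹' Set.Ioi 0 := by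
  ext ω
  simp [signEvent, sign_eq_one_iff]

lemma signEvent_neg_one_eq (t : ℕ) : M.signEvent t (-1) = M.X t ⁻¹' Set.Iio 0 := by
  ext ω
  simp [signEvent, sign_eq_neg_one_iff]

/-- The expected squared error of one step, and its finiteness. -/
lemma integral_error_sq (hp : SourceDensity pX) (hX : M.IsIIDSource pX) (hV : M.ChannelNoise)
    (hP : 0 < M.power) {t : ℕ} (ht : t ∈ Set.Icc 1 M.T) {f : Strategy} {e : ℕ}
    (hf : Measurable fun x => f t x e) :
    Integrable (fun ω => (M.X t ω - M.estimate f t e ω) ^ 2) M.P ∧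
    ∫ ω, (M.X t ω - M.estimate f t e ω) ^ 2 ∂M.P =
      stageCost pX (1 / (M.snr + 1)) 0 (silentSet f t e) := by
  have := hX.isProb
  have hi := hX.integrable_density hp ht
  have h1 := hX.moment_zero_univ hp ht
  have hXm := hX.measurable_X t ht
  have hhalf := moment_zero_Ioi_zero hp hi h1
  set B := silentSet f t e with hBdef
  have hB : MeasurableSet B := measurableSet_silentSet hf
  have hBp : MeasurableSet (Bᶜ ∩ Set.Ioi 0) := hB.compl.inter measurableSet_Ioi
  have hBn : MeasurableSet (Bᶜ ∩ Set.Iio 0) := hB.compl.inter measurableSet_Iio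
  have hsent : ∀ x ∈ Bᶜ, f t x e = true := fun x hx => by simpa [hBdef, silentSet] using hx
  obtain ⟨ip, ep⟩ := setIntegral_sent_sq (s := 1) hp hX hV hP ht (by decide) hBp
    (fun x hx => sign_eq_one_iff.2 hx.2)
    (by rw [signEvent_one_eq, hX.real_preimage hp ht measurableSet_Ioi, hhalf]; norm_num)
    (fun x hx => hsent x hx.1) (sent_one_eq f t e)
  obtain ⟨im, em⟩ := setIntegral_sent_sq (s := -1) hp hX hV hP ht (by decide) hBn
    (fun x hx => sign_eq_neg_one_iff.2 hx.2)
    (by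
      have := moment_inter_Iio hp 0 Set.univ
      simp only [negPart, Set.preimage_univ, Set.univ_inter, pow_zero, one_mul, hhalf] at this
      rw [signEvent_neg_one_eq, hX.real_preimage hp ht measurableSet_Iio, this]
      norm_num)
    (fun x hx => hsent x hx.1) (sent_neg_one_eq f t e)
  have hsil : ∀ ω ∈ M.X t ⁻¹' B, (M.X t ω - M.estimate f t e ω) ^ 2 =
      (M.X t ω - M.condMean t (M.X t ⁻¹' B)) ^ 2 := by
    intro ω hω
    have : f t (M.X t ω) e = false := hω
    rw [estimate_eq, estimateFun]
    simp only [this, silent_eq]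
    simp [hBdef]
  have i0 : IntegrableOn (fun ω => (M.X t ω - M.estimate f t e ω) ^ 2) (M.X t ⁻¹' B) M.P :=
    (integrableOn_congr_fun hsil (hXm hB)).2
      ((hX.memLp_X hp ht).sub (memLp_const _)).integrable_sq.integrableOn
  have e0 : ∫ ω in M.X t ⁻¹' B, (M.X t ω - M.estimate f t e ω) ^ 2 ∂M.P = scatter pX B := by
    rw [setIntegral_congr_fun (hXm hB) hsil, hX.setIntegral_sub_condMean_sq hp ht hB]
  have hcover : (M.X t ⁻¹' B ∪ (M.X t ⁻¹' (Bᶜ ∩ Set.Ioi 0) ∪ M.X t ⁻¹' (Bᶜ ∩ Set.Iio 0)) : Set Ω)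
      =ᵐ[M.P] Set.univ := by
    rw [ae_eq_univ]
    have h0 : M.P (M.X t ⁻¹' {0}) = 0 := by
      have h0 : moment pX 0 {0} = 0 := by
        rw [moment, Measure.restrict_eq_zero.2 Real.volume_singleton, integral_zero_measure]
      have := hX.measure_pos_iff hp ht (measurableSet_singleton (0 : ℝ))
      rw [h0] at this
      simpa using this
    refine measure_mono_null (fun ω hω => ?_) h0
    simp only [Set.mem_compl_iff, Set.mem_union, Set.mem_preimage, Set.mem_inter_iff, Set.mem_Ioi,
      Set.mem_Iio, not_or, not_and, not_lt] at hω
    exact le_antisymm (hω.2.1 hω.1) (hω.2.2 hω.1)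
  have hd1 : Disjoint (M.X t ⁻¹' (Bᶜ ∩ Set.Ioi 0)) (M.X t ⁻¹' (Bᶜ ∩ Set.Iio 0)) :=
    Set.disjoint_left.2 fun ω h h' => lt_asymm (Set.mem_Ioi.1 h.2) (Set.mem_Iio.1 h'.2)
  have hd2 : Disjoint (M.X t ⁻¹' B)
      (M.X t ⁻¹' (Bᶜ ∩ Set.Ioi 0) ∪ M.X t ⁻¹' (Bᶜ ∩ Set.Iio 0)) :=
    Set.disjoint_left.2 fun ω h h' => by
      rcases h' with h' | h' <;> exact h'.1 h
  have iu := i0.union (ip.union im)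
  constructor
  · rw [← integrableOn_univ]
    exact iu.congr_set_ae hcover.symm
  · rw [← setIntegral_univ, ← setIntegral_congr_set hcover,
      setIntegral_union hd2 ((hXm hBp).union (hXm hBn)) i0 (ip.union im),
      setIntegral_union hd1 (hXm hBn) ip im, e0, ep, em, stageCost]
    ring

/-! ### Dynamic programming -/

/-- The accumulated squared error from time `t` on, starting with `e` opportunities. -/
def errorToGo (M : Model Ω) (f : Strategy) (t e : ℕ) (ω : Ω) : ℝ :=
  ∑ k ∈ Finset.range (M.T + 1 - t),
    (M.X (t + k) ω - M.estimate f (t + k) (M.budget f t e ω k) ω) ^ 2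

lemma costToGo_eq (f : Strategy) (t e : ℕ) :
    M.costToGo f t e = ∫ ω, M.errorToGo f t e ω ∂M.P := rfl

lemma budget_succ (f : Strategy) (t e : ℕ) (ω : Ω) (k : ℕ) : M.budget f t e ω (k + 1) =
    M.budget f (t + 1) (e - (f t (M.X t ω) e).toNat) ω k := by
  induction k with
  | zero => rfl
  | succ k ih =>
    rw [budget, ih, budget]
    have : t + (k + 1) = t + 1 + k := by ring
    rw [this]

lemma errorToGo_of_le {f : Strategy} {t : ℕ} (ht : t ≤ M.T) (e : ℕ) (ω : Ω) :
    M.errorToGo f t e ω = (M.X t ω - M.estimate f t e ω) ^ 2 +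
      if f t (M.X t ω) e then M.errorToGo f (t + 1) (e - 1) ω else M.errorToGo f (t + 1) e ω := by
  have h : M.T + 1 - t = (M.T + 1 - (t + 1)) + 1 := by omega
  have hrec : M.errorToGo f t e ω = (M.X t ω - M.estimate f t e ω) ^ 2 +
      M.errorToGo f (t + 1) (e - (f t (M.X t ω) e).toNat) ω := by
    rw [errorToGo, h, Finset.sum_range_succ', add_comm]
    simp only [budget_succ, errorToGo]
    congr 1
    refine Finset.sum_congr rfl fun k _ => ?_
    have : t + (k + 1) = t + 1 + k := by ring
    rw [this]
  rw [hrec]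
  cases f t (M.X t ω) e <;> simp

lemma errorToGo_of_lt {f : Strategy} {t : ℕ} (ht : M.T < t) (e : ℕ) :
    M.errorToGo f t e = fun _ => 0 := by
  ext ω
  have : M.T + 1 - t = 0 := by omega
  simp [errorToGo, this]

lemma costToGo_of_lt (f : Strategy) {t : ℕ} (ht : M.T < t) (e : ℕ) : M.costToGo f t e = 0 := by
  rw [costToGo_eq, errorToGo_of_lt ht]
  simp

/-- The accumulated error from time `t` on depends only on the source and the noise from then on:
it is measurable for every σ-algebra that makes these measurable. The σ-algebra is put on a second
type, mapped to the probability space by `φ`. -/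
lemma measurable_errorToGo {f : Strategy}
    (hf : ∀ t ∈ Set.Icc 1 M.T, ∀ e, Measurable fun x => f t x e)
    {Ω' : Type*} [m : MeasurableSpace Ω'] (φ : Ω' → Ω) (d : ℕ) :
    ∀ t, 1 ≤ t → M.T + 1 - t = d →
      (∀ s ∈ Set.Icc t M.T, Measurable fun ω => (M.X s (φ ω), M.V s (φ ω))) →
      ∀ e, Measurable fun ω => M.errorToGo f t e (φ ω) := by
  induction d with
  | zero =>
    intro t _ hd _ e
    rw [errorToGo_of_lt (by omega)]
    exact measurable_const
  | succ d ih =>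
    intro t ht hd hm e
    have htT : t ≤ M.T := by omega
    have hz := hm t ⟨le_rfl, htT⟩
    have hnext := ih (t + 1) (by omega) (by omega) fun s hs => hm s ⟨by have := hs.1; omega, hs.2⟩
    have hft := hf t ⟨ht, htT⟩ e
    have heq : (fun ω => M.errorToGo f t e (φ ω)) = fun ω =>
        (fun z : ℝ × ℝ => (z.1 - M.estimateFun f t e z) ^ 2) (M.X t (φ ω), M.V t (φ ω)) +
        if f t (M.X t (φ ω)) e then M.errorToGo f (t + 1) (e - 1) (φ ω)
          else M.errorToGo f (t + 1) e (φ ω) := by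
      ext ω
      rw [errorToGo_of_le htT, estimate_eq]
    rw [heq]
    have hsq : Measurable fun z : ℝ × ℝ => (z.1 - M.estimateFun f t e z) ^ 2 :=
      (measurable_fst.sub (measurable_estimateFun hft)).pow_const 2
    have hset : MeasurableSet {ω | f t (M.X t (φ ω)) e = true} :=
      ((hft.comp measurable_fst).comp hz) (measurableSet_singleton true)
    exact (hsq.comp hz).add (Measurable.ite hset (hnext (e - 1)) (hnext e))

lemma IsIIDSource.measurable_pair (hX : M.IsIIDSource pX) {t : ℕ} (ht : t ∈ Set.Icc 1 M.T) :
    Measurable fun ω => (M.X t ω, M.V t ω) :=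
  (hX.measurable_X t ht).prodMk (hX.measurable_V t ht)

/-- The present is independent of the future error with a given number of opportunities. -/
lemma indepFun_errorToGo (hX : M.IsIIDSource pX) {f : Strategy}
    (hf : ∀ t ∈ Set.Icc 1 M.T, ∀ e, Measurable fun x => f t x e) {t : ℕ}
    (ht : t ∈ Set.Icc 1 M.T) (e : ℕ) : IndepFun (M.X t) (M.errorToGo f (t + 1) e) M.P := by
  set Z : Set.Icc 1 M.T → Ω → ℝ × ℝ := fun s ω => (M.X s ω, M.V s ω) with hZ
  set m : Set.Icc 1 M.T → MeasurableSpace Ω := fun s =>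
    MeasurableSpace.comap (Z s) inferInstance with hm
  have hle : ∀ s, m s ≤ ‹MeasurableSpace Ω› := fun s => (hX.measurable_pair s.2).comap_le
  have hdisj : Disjoint ({⟨t, ht⟩} : Set (Set.Icc 1 M.T)) {s | t < s} := by
    simp
  have hind : Indep (⨆ i ∈ ({⟨t, ht⟩} : Set (Set.Icc 1 M.T)), m i)
      (⨆ i ∈ {s : Set.Icc 1 M.T | t < s}, m i) M.P :=
    indep_iSup_of_disjoint hle hX.indep hdisj
  rw [IndepFun_iff_Indep]
  refine indep_of_indep_of_le_left (indep_of_indep_of_le_right hind ?_) ?_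
  · refine Measurable.comap_le ?_
    refine measurable_errorToGo hf (m := ⨆ i ∈ {s : Set.Icc 1 M.T | t < s}, m i) id _ (t + 1)
      (by omega) rfl (fun s hs => ?_) e
    have hs' : s ∈ Set.Icc 1 M.T := ⟨by have := hs.1; omega, hs.2⟩
    have h1 : Measurable[m ⟨s, hs'⟩] (Z ⟨s, hs'⟩) := comap_measurable _
    exact h1.mono (le_iSup₂_of_le ⟨s, hs'⟩ (show t < s by have := hs.1; omega) le_rfl) le_rfl
  · refine Measurable.comap_le ?_
    have h1 : Measurable[m ⟨t, ht⟩] (Z ⟨t, ht⟩) := comap_measurable _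
    exact (measurable_fst.comp h1).mono (le_iSup₂_of_le ⟨t, ht⟩ rfl le_rfl) le_rfl

lemma integrable_errorToGo (hp : SourceDensity pX) (hX : M.IsIIDSource pX) (hV : M.ChannelNoise)
    (hP : 0 < M.power) {f : Strategy}
    (hf : ∀ t ∈ Set.Icc 1 M.T, ∀ e, Measurable fun x => f t x e) (d : ℕ) :
    ∀ t, 1 ≤ t → M.T + 1 - t = d → ∀ e, Integrable (M.errorToGo f t e) M.P := by
  induction d with
  | zero =>
    intro t _ hd e
    rw [errorToGo_of_lt (by omega)]
    exact integrable_zero _ _ _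
  | succ d ih =>
    intro t ht hd e
    have htT : t ∈ Set.Icc 1 M.T := ⟨ht, by omega⟩
    have hnext := ih (t + 1) (by omega) (by omega)
    have hset : MeasurableSet {ω | f t (M.X t ω) e = true} :=
      ((hf t htT e).comp (hX.measurable_X t htT)) (measurableSet_singleton true)
    have heq : M.errorToGo f t e = fun ω => (M.X t ω - M.estimate f t e ω) ^ 2 +
        ({ω | f t (M.X t ω) e = true}.indicator (M.errorToGo f (t + 1) (e - 1)) ω +
          {ω | f t (M.X t ω) e = true}ᶜ.indicator (M.errorToGo f (t + 1) e) ω) := by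
      ext ω
      rw [errorToGo_of_le htT.2]
      by_cases h : f t (M.X t ω) e = true <;> simp [h]
    rw [heq]
    exact (integral_error_sq hp hX hV hP htT (hf t htT e)).1.add
      (((hnext (e - 1)).indicator hset).add ((hnext e).indicator hset.compl))

/-- The Bellman equation of a strategy. -/
lemma costToGo_step (hp : SourceDensity pX) (hX : M.IsIIDSource pX) (hV : M.ChannelNoise)
    (hP : 0 < M.power) {f : Strategy}
    (hf : ∀ t ∈ Set.Icc 1 M.T, ∀ e, Measurable fun x => f t x e) {t : ℕ}
    (ht : t ∈ Set.Icc 1 M.T) (e : ℕ) : M.costToGo f t e =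
      stageCost pX (1 / (M.snr + 1)) 0 (silentSet f t e) +
        moment pX 0 (silentSet f t e) * M.costToGo f (t + 1) e +
        (1 - moment pX 0 (silentSet f t e)) * M.costToGo f (t + 1) (e - 1) := by
  have := hX.isProb
  have hi := hX.integrable_density hp ht
  set B := silentSet f t e with hBdef
  have hB : MeasurableSet B := measurableSet_silentSet (hf t ht e)
  have hXm := hX.measurable_X t ht
  obtain ⟨is, es⟩ := integral_error_sq hp hX hV hP ht (hf t ht e)
  have hnext := fun e => integrable_errorToGo hp hX hV hP hf _ (t + 1) (by omega) rfl e
  have heq : ∀ ω, M.errorToGo f t e ω = (M.X t ω - M.estimate f t e ω) ^ 2 +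
      ((M.X t ⁻¹' B).indicator (M.errorToGo f (t + 1) e) ω +
        (M.X t ⁻¹' Bᶜ).indicator (M.errorToGo f (t + 1) (e - 1)) ω) := by
    intro ω
    rw [errorToGo_of_le ht.2]
    cases h : f t (M.X t ω) e <;> simp [hBdef, silentSet, h]
  have hfac : ∀ (A : Set ℝ) (e : ℕ), MeasurableSet A →
      ∫ ω, (M.X t ⁻¹' A).indicator (M.errorToGo f (t + 1) e) ω ∂M.P =
        moment pX 0 A * M.costToGo f (t + 1) e := by
    intro A e hA
    have hind := (indepFun_errorToGo hX hf ht e).integral_fun_comp_mul_comp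
      (f := A.indicator fun _ => (1 : ℝ)) (g := fun y => y) hXm.aemeasurable
      (hnext e).aemeasurable ((measurable_const.indicator hA).aestronglyMeasurable)
      measurable_id.aestronglyMeasurable
    have e1 : ∀ ω, A.indicator (fun _ => (1 : ℝ)) (M.X t ω) * M.errorToGo f (t + 1) e ω =
        (M.X t ⁻¹' A).indicator (M.errorToGo f (t + 1) e) ω := fun ω => by
      by_cases h : M.X t ω ∈ A <;> simp [h]
    have e2 : ∀ ω, A.indicator (fun _ => (1 : ℝ)) (M.X t ω) =
        (M.X t ⁻¹' A).indicator (fun _ => (1 : ℝ)) ω := fun ω => by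
      by_cases h : M.X t ω ∈ A <;> simp [h]
    simp only [e1] at hind
    simp only [e2] at hind
    rw [hind, integral_indicator (hXm hA), setIntegral_const, smul_eq_mul, mul_one,
      hX.real_preimage hp ht hA]
    rfl
  have hcompl : moment pX 0 Bᶜ = 1 - moment pX 0 B := by
    rw [← hX.moment_zero_univ hp ht, ← moment_add_compl hp hi 0 hB]
    ring
  have hadd := integral_add is (((hnext e).indicator (hXm hB)).add
    ((hnext (e - 1)).indicator (hXm hB.compl)))
  simp only [Pi.add_apply] at hadd
  rw [costToGo_eq, integral_congr_ae (Filter.Eventually.of_forall heq), hadd,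
    integral_add ((hnext e).indicator (hXm hB)) ((hnext (e - 1)).indicator (hXm hB.compl)),
    hfac B e hB, hfac Bᶜ (e - 1) hB.compl, es, hcompl]
  ring

lemma costToGo_nonneg (f : Strategy) (t e : ℕ) : 0 ≤ M.costToGo f t e :=
  integral_nonneg fun _ => Finset.sum_nonneg fun _ _ => sq_nonneg _

lemma optCost_le {f : Strategy} (hf : M.Admissible f) (t e : ℕ) :
    M.optCost t e ≤ M.costToGo f t e :=
  csInf_le ⟨0, by rintro _ ⟨g, _, rfl⟩; exact costToGo_nonneg g t e⟩ ⟨f, hf, rfl⟩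

lemma optCost_eq_of_forall_le {f : Strategy} (hf : M.Admissible f) {t e : ℕ}
    (h : ∀ g, M.Admissible g → M.costToGo f t e ≤ M.costToGo g t e) :
    M.costToGo f t e = M.optCost t e :=
  le_antisymm (le_csInf ⟨_, f, hf, rfl⟩ (by rintro _ ⟨g, hg, rfl⟩; exact h g hg))
    (optCost_le hf t e)

/-! ### Threshold strategies -/

lemma snr_pos (hV : M.ChannelNoise) (hP : 0 < M.power) : 0 < M.snr := div_pos hP hV.var_pos

lemma inv_snr_pos (hV : M.ChannelNoise) (hP : 0 < M.power) : 0 < 1 / (M.snr + 1) := by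
  have := snr_pos hV hP
  positivity

lemma inv_snr_le_one (hV : M.ChannelNoise) (hP : 0 < M.power) : 1 / (M.snr + 1) ≤ 1 := by
  have := snr_pos hV hP
  rw [div_le_one (by positivity)]
  linarith

lemma isThreshold_iff (hp : SourceDensity pX) (hX : M.IsIIDSource pX) {t : ℕ}
    (ht : t ∈ Set.Icc 1 M.T) {e : ℕ} {b : ℝ} :
    M.IsThreshold t e b ↔ IsBalanced pX (1 / (M.snr + 1)) (M.oppCost t e) b := by
  have : M.residual t b = meanResidual pX b := by
    rw [residual, meanResidual, ← hX.condMean_preimage hp ht measurableSet_Ioi]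
    rfl
  rw [IsThreshold, IsBalanced, this]

lemma silentSet_thresholdStrategy (β : ℕ → ℕ → ℝ) (t : ℕ) {e : ℕ} (he : 0 < e) :
    silentSet (thresholdStrategy β) t e = Set.Icc (-β t e) (β t e) := by
  ext x
  simp [silentSet, thresholdStrategy, he, abs_le]

lemma silentSet_zero {f : Strategy} (hf : M.Admissible f) {t : ℕ} (ht : t ∈ Set.Icc 1 M.T) :
    silentSet f t 0 = Set.univ := by
  ext x
  have := hf.hard t ht x 0
  cases h : f t x 0 <;> simp_all [silentSet]

lemma measurable_thresholdStrategy (β : ℕ → ℕ → ℝ) (t e : ℕ) :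
    Measurable fun x => thresholdStrategy β t x e := by
  refine measurable_to_bool ?_
  have : (fun x => thresholdStrategy β t x e) ⁻¹' {true} = {x | 0 < e ∧ β t e < |x|} := by
    ext x
    simp [thresholdStrategy]
  rw [this]
  exact (MeasurableSet.const _).inter (measurableSet_lt measurable_const measurable_abs)

/-- Positive thresholds are admissible: the mean of the silent interval is `0` by symmetry. -/
lemma admissible_thresholdStrategy (hp : SourceDensity pX) (hX : M.IsIIDSource pX)
    {β : ℕ → ℕ → ℝ} (hβ : ∀ t ∈ Set.Icc 1 M.T, ∀ e, 0 < e → 0 < β t e) :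
    M.Admissible (thresholdStrategy β) := by
  have hm := measurable_thresholdStrategy β
  have hsets : ∀ t ∈ Set.Icc 1 M.T, ∀ e, 0 < e →
      0 < moment pX 0 (silentSet (thresholdStrategy β) t e) ∧
      0 < moment pX 0 ((silentSet (thresholdStrategy β) t e)ᶜ ∩ Set.Iio 0) ∧
      0 < moment pX 0 ((silentSet (thresholdStrategy β) t e)ᶜ ∩ Set.Ioi 0) ∧
      moment pX 1 (silentSet (thresholdStrategy β) t e) = 0 ∧
      moment pX 1 ((silentSet (thresholdStrategy β) t e)ᶜ ∩ Set.Iio 0) < 0 ∧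
      0 < moment pX 1 ((silentSet (thresholdStrategy β) t e)ᶜ ∩ Set.Ioi 0) := by
    intro t ht e he
    have hi := hX.integrable_density hp ht
    have hb := hβ t ht e he
    rw [silentSet_thresholdStrategy β t he, compl_Icc_inter_Ioi hb.le hb.le,
      compl_Icc_inter_Iio hb.le hb.le, moment_neg_preimage hp, moment_neg_preimage hp,
      moment_Icc hp hi 1 hb.le hb.le]
    have hQ := moment_zero_Ioi_pos hp hi (β t e)
    have hL : 0 < moment pX 1 (Set.Ioi (β t e)) := by
      have := meanResidual_pos hp hi (β t e)
      rw [meanResidual, sub_pos, lt_div_iff₀ hQ] at this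
      exact (mul_pos hb hQ).trans this
    refine ⟨?_, by simpa using hQ, hQ, by ring, by linarith, hL⟩
    refine lt_of_le_of_ne (moment_zero_nonneg hp _) fun h0 => ?_
    have := volume_eq_zero_of_moment_zero hp hi h0.symm
    rw [Real.volume_Icc, ENNReal.ofReal_eq_zero] at this
    linarith
  have hB := fun t e => measurableSet_silentSet (hm t e)
  have hBn := fun t e => (hB t e).compl.inter (measurableSet_Iio (a := (0 : ℝ)))
  have hBp := fun t e => (hB t e).compl.inter (measurableSet_Ioi (a := (0 : ℝ)))
  constructor
  · exact fun t _ e => hm t e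
  · intro t _ x e
    rcases Nat.eq_zero_or_pos e with rfl | he
    · simp [thresholdStrategy]
    · exact (Bool.toNat_le _).trans he
  · intro t ht e he
    rw [silent_eq, hX.measure_pos_iff hp ht (hB t e)]
    exact (hsets t ht e he).1
  · intro t ht e he
    rw [sent_neg_one_eq, hX.measure_pos_iff hp ht (hBn t e)]
    exact (hsets t ht e he).2.1
  · intro t ht e he
    rw [sent_one_eq, hX.measure_pos_iff hp ht (hBp t e)]
    exact (hsets t ht e he).2.2.1
  · intro t ht e he
    obtain ⟨_, h2, _, h4, h5, _⟩ := hsets t ht e he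
    rw [silent_eq, sent_neg_one_eq, hX.condMean_preimage hp ht (hB t e),
      hX.condMean_preimage hp ht (hBn t e), h4, zero_div]
    exact div_neg_of_neg_of_pos h5 h2
  · intro t ht e he
    obtain ⟨_, _, h3, h4, _, h6⟩ := hsets t ht e he
    rw [silent_eq, sent_one_eq, hX.condMean_preimage hp ht (hB t e),
      hX.condMean_preimage hp ht (hBp t e), h4, zero_div]
    exact div_pos h6 h3

/-- The one-step bound for an admissible strategy. -/
lemma Admissible.thresholdCost_le (hp : SourceDensity pX) (hX : M.IsIIDSource pX)
    (hV : M.ChannelNoise) (hP : 0 < M.power) {f : Strategy} (hf : M.Admissible f) {t : ℕ}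
    (ht : t ∈ Set.Icc 1 M.T) {e : ℕ} (he : 0 < e) {c b : ℝ}
    (hb : IsBalanced pX (1 / (M.snr + 1)) c b) :
    thresholdCost pX (1 / (M.snr + 1)) c b ≤
      stageCost pX (1 / (M.snr + 1)) c (silentSet f t e) := by
  have hB := measurableSet_silentSet (hf.measurable t ht e)
  have hBn := hB.compl.inter (measurableSet_Iio (a := (0 : ℝ)))
  have hBp := hB.compl.inter (measurableSet_Ioi (a := (0 : ℝ)))
  have a0 := hf.silent_pos t ht e he
  have a1 := hf.sent_neg_pos t ht e he
  have a2 := hf.sent_pos_pos t ht e he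
  have a3 := hf.neg_lt t ht e he
  have a4 := hf.lt_pos t ht e he
  rw [silent_eq] at a0 a3 a4
  rw [sent_neg_one_eq] at a1 a3
  rw [sent_one_eq] at a2 a4
  rw [hX.condMean_preimage hp ht hB] at a3 a4
  rw [hX.condMean_preimage hp ht hBn] at a3
  rw [hX.condMean_preimage hp ht hBp] at a4
  rw [hX.measure_pos_iff hp ht hB] at a0
  rw [hX.measure_pos_iff hp ht hBn] at a1
  rw [hX.measure_pos_iff hp ht hBp] at a2
  exact thresholdCost_le_stageCost hp (hX.integrable_density hp ht) (hX.moment_zero_univ hp ht)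
    (inv_snr_pos hV hP).le (inv_snr_le_one hV hP) hb hB a0 a2 a1 a3.le a4.le

/-- The Bellman equation with the price `J' - J` of a transmission made explicit. -/
lemma stageCost_add (hp : SourceDensity pX) (hX : M.IsIIDSource pX) {t : ℕ}
    (ht : t ∈ Set.Icc 1 M.T) {B : Set ℝ} (hB : MeasurableSet B) (κ J J' : ℝ) :
    stageCost pX κ 0 B + moment pX 0 B * J + (1 - moment pX 0 B) * J' =
      J + stageCost pX κ (J' - J) B := by
  rw [stageCost, stageCost, moment_zero_compl hp (hX.integrable_density hp ht)
    (hX.moment_zero_univ hp ht) hB]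
  ring

lemma moment_zero_le_one (hp : SourceDensity pX) (hX : M.IsIIDSource pX) {t : ℕ}
    (ht : t ∈ Set.Icc 1 M.T) {B : Set ℝ} (hB : MeasurableSet B) : moment pX 0 B ≤ 1 := by
  have := moment_add_compl hp (hX.integrable_density hp ht) 0 hB
  rw [hX.moment_zero_univ hp ht] at this
  linarith [moment_zero_nonneg hp Bᶜ]

lemma costToGo_zero (hp : SourceDensity pX) (hX : M.IsIIDSource pX) (hV : M.ChannelNoise)
    (hP : 0 < M.power) {f : Strategy} (hf : M.Admissible f) {t : ℕ} (ht : t ∈ Set.Icc 1 M.T) :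
    M.costToGo f t 0 = M.costToGo f (t + 1) 0 + scatter pX Set.univ := by
  rw [costToGo_step hp hX hV hP hf.measurable ht, silentSet_zero hf ht,
    hX.moment_zero_univ hp ht, stageCost]
  simp only [Set.compl_univ, Set.empty_inter, zero_mul, one_mul, sub_self, add_zero]
  simp [scatter, moment, add_comm]

/-- If a threshold strategy attains the optimal cost from time `t + 1` on, and its thresholds at
time `t` are balanced, then it attains the optimal cost from time `t` on; the optimal cost then
obeys the Bellman recursion. -/
lemma optCost_step (hp : SourceDensity pX) (hX : M.IsIIDSource pX) (hV : M.ChannelNoise)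
    (hP : 0 < M.power) {β : ℕ → ℕ → ℝ} (hadm : M.Admissible (thresholdStrategy β)) {t : ℕ}
    (ht : t ∈ Set.Icc 1 M.T)
    (hnext : ∀ e, M.costToGo (thresholdStrategy β) (t + 1) e = M.optCost (t + 1) e)
    (hβ : ∀ e, 0 < e → IsBalanced pX (1 / (M.snr + 1)) (M.oppCost t e) (β t e)) :
    (∀ e, M.costToGo (thresholdStrategy β) t e = M.optCost t e) ∧
      M.optCost t 0 = M.optCost (t + 1) 0 + scatter pX Set.univ ∧
      ∀ e, 0 < e → M.optCost t e = M.optCost (t + 1) e +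
        thresholdCost pX (1 / (M.snr + 1)) (M.oppCost t e) (β t e) := by
  have h0 : M.costToGo (thresholdStrategy β) t 0 = M.optCost t 0 := by
    refine optCost_eq_of_forall_le hadm fun g hg => ?_
    rw [costToGo_zero hp hX hV hP hadm ht, costToGo_zero hp hX hV hP hg ht, hnext]
    linarith [optCost_le hg (t + 1) 0]
  have hval : ∀ e, 0 < e → M.costToGo (thresholdStrategy β) t e = M.optCost (t + 1) e +
      thresholdCost pX (1 / (M.snr + 1)) (M.oppCost t e) (β t e) := by
    intro e he
    rw [costToGo_step hp hX hV hP hadm.measurable ht, hnext, hnext,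
      stageCost_add hp hX ht (measurableSet_silentSet (hadm.measurable t ht e)),
      silentSet_thresholdStrategy β t he]
    rfl
  have hpos : ∀ e, 0 < e → M.costToGo (thresholdStrategy β) t e = M.optCost t e := by
    intro e he
    refine optCost_eq_of_forall_le hadm fun g hg => ?_
    have hB := measurableSet_silentSet (hg.measurable t ht e)
    rw [hval e he, costToGo_step hp hX hV hP hg.measurable ht]
    have h1 := hg.thresholdCost_le hp hX hV hP ht he (hβ e he)
    have h2 := stageCost_add hp hX ht hB (1 / (M.snr + 1)) (M.optCost (t + 1) e)
      (M.optCost (t + 1) (e - 1))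
    have h3 := mul_le_mul_of_nonneg_left (optCost_le hg (t + 1) e) (moment_zero_nonneg hp
      (silentSet g t e))
    have h4 := mul_le_mul_of_nonneg_left (optCost_le hg (t + 1) (e - 1))
      (sub_nonneg.2 (moment_zero_le_one hp hX ht hB))
    rw [oppCost] at h1 ⊢
    linarith
  refine ⟨fun e => ?_, ?_, fun e he => ?_⟩
  · rcases Nat.eq_zero_or_pos e with rfl | he
    · exact h0
    · exact hpos e he
  · rw [← h0, costToGo_zero hp hX hV hP hadm ht, hnext]
  · rw [← hpos e he, hval e he]

/-- Backward induction in time. The opportunity cost stays nonnegative because the optimal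
one-step cost increases with the price of a transmission at a rate at most `1` and never exceeds
the cost of silence; this in turn makes the balance equation solvable one step earlier. -/
theorem optimal_thresholdStrategy (hp : SourceDensity pX) (hX : M.IsIIDSource pX)
    (hV : M.ChannelNoise) (hP : 0 < M.power) {β : ℕ → ℕ → ℝ}
    (hadm : M.Admissible (thresholdStrategy β))
    (hβ : ∀ t ∈ Set.Icc 1 M.T, ∀ e, 0 < e → 0 ≤ M.oppCost t e →
      IsBalanced pX (1 / (M.snr + 1)) (M.oppCost t e) (β t e)) (d : ℕ) :
    ∀ t, 1 ≤ t → M.T + 1 - t = d →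
      (∀ e, M.costToGo (thresholdStrategy β) t e = M.optCost t e) ∧
      ∀ e, 0 < e → M.optCost t e ≤ M.optCost t (e - 1) := by
  induction d with
  | zero =>
    intro t _ hd
    have hlt : M.T < t := by omega
    have hopt : ∀ e, M.costToGo (thresholdStrategy β) t e = M.optCost t e := fun e =>
      optCost_eq_of_forall_le hadm fun g _ => by
        rw [costToGo_of_lt _ hlt, costToGo_of_lt _ hlt]
    refine ⟨hopt, fun e _ => ?_⟩
    rw [← hopt, ← hopt, costToGo_of_lt _ hlt, costToGo_of_lt _ hlt]
  | succ d ih =>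
    intro t h1t hd
    have ht : t ∈ Set.Icc 1 M.T := ⟨h1t, by omega⟩
    have hi := hX.integrable_density hp ht
    have h1 := hX.moment_zero_univ hp ht
    have hκ0 := (inv_snr_pos hV hP).le
    have hκ1 := inv_snr_le_one hV hP
    obtain ⟨hnext, hmono⟩ := ih (t + 1) (by omega) (by omega)
    have hc : ∀ e, 0 < e → 0 ≤ M.oppCost t e := fun e he => sub_nonneg.2 (hmono e he)
    have hb := fun e he => hβ t ht e he (hc e he)
    obtain ⟨hopt, hrec0, hrec⟩ := optCost_step hp hX hV hP hadm ht hnext hb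
    refine ⟨hopt, fun e he => ?_⟩
    have hce : M.oppCost t e = M.optCost (t + 1) (e - 1) - M.optCost (t + 1) e := rfl
    rw [hrec e he]
    rcases Nat.eq_zero_or_pos (e - 1) with he1 | he1
    · rw [he1] at hce ⊢
      rw [hrec0]
      have := thresholdCost_le_scatter_univ hp hi hκ0 hκ1 (hc e he) (hb e he)
      linarith [hc e he]
    · rw [hrec (e - 1) he1]
      rcases le_total (M.oppCost t e) (M.oppCost t (e - 1)) with hle | hle
      · have := thresholdCost_mono hp hi hκ0 hle (hb e he) (hb _ he1)
        linarith [hc e he]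
      · have := thresholdCost_lipschitz hp hi h1 hκ0 hle (hb _ he1) (hb e he)
        linarith [hc _ he1]

lemma oppCost_nonneg (hp : SourceDensity pX) (hX : M.IsIIDSource pX)
    (hV : M.ChannelNoise) (hP : 0 < M.power) {t e : ℕ}
    (he : 0 < e) : 0 ≤ M.oppCost t e := by
  classical
  -- the value `1` is used only where no positive balanced threshold exists
  let β : ℕ → ℕ → ℝ := fun t e =>
    if h : ∃ b, IsBalanced pX (1 / (M.snr + 1)) (M.oppCost t e) b ∧ 0 < b then h.choose else 1
  have hpos : ∀ t e, 0 < β t e := by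
    intro t e
    simp only [β]
    split_ifs with h
    · exact h.choose_spec.2
    · exact one_pos
  have hbal : ∀ t ∈ Set.Icc 1 M.T, ∀ e, 0 < e → 0 ≤ M.oppCost t e →
      IsBalanced pX (1 / (M.snr + 1)) (M.oppCost t e) (β t e) := by
    intro t ht e _ hc
    have hi := hX.integrable_density hp ht
    obtain ⟨b, hb, -⟩ := existsUnique_isBalanced hp hi (inv_snr_pos hV hP).le hc
    have h : ∃ b, IsBalanced pX (1 / (M.snr + 1)) (M.oppCost t e) b ∧ 0 < b :=
      ⟨b, hb, hb.pos hp hi (inv_snr_pos hV hP) hc⟩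
    simp only [β, dif_pos h]
    exact h.choose_spec.1
  have hadm := admissible_thresholdStrategy (β := β) hp hX fun t _ e _ => hpos t e
  exact sub_nonneg.2
    ((optimal_thresholdStrategy hp hX hV hP hadm hbal _ (t + 1) (by omega) rfl).2 e he)

end Model

end RemoteEstimation

end

open RemoteEstimation RemoteEstimation.Model in
theorem theorem4 {Ω : Type*} [MeasurableSpace Ω] (M : RemoteEstimation.Model Ω) (pX : ℝ → ℝ)
    (hpX : RemoteEstimation.SourceDensity pX) (hX : M.IsIIDSource pX) (hV : M.ChannelNoise)
    (hP : 0 < M.power) :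
    -- the fixed-point equation has exactly one nonnegative solution
    (∀ t ∈ Set.Icc 1 M.T, ∀ e, 0 < e → ∃! b, M.IsThreshold t e b) ∧
    -- the strategy with these thresholds is admissible and optimal
    ∀ β : ℕ → ℕ → ℝ, (∀ t ∈ Set.Icc 1 M.T, ∀ e, 0 < e → M.IsThreshold t e (β t e)) →
      M.Admissible (RemoteEstimation.thresholdStrategy β) ∧
      -- it solves the problem over the whole horizon with at most `N` transmissions
      (∀ N : ℕ, ∀ f, M.Admissible f →
        M.costToGo (RemoteEstimation.thresholdStrategy β) 1 N ≤ M.costToGo f 1 N) ∧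
      -- it attains the optimal cost to go from every time and every budget
      (∀ t ∈ Set.Icc 1 M.T, ∀ e,
        M.costToGo (RemoteEstimation.thresholdStrategy β) t e = M.optCost t e) ∧
      -- no other thresholds do
      (∀ b : ℕ → ℕ → ℝ, M.Admissible (RemoteEstimation.thresholdStrategy b) →
        (∀ t ∈ Set.Icc 1 M.T, ∀ e,
          M.costToGo (RemoteEstimation.thresholdStrategy b) t e = M.optCost t e) →
        ∀ t ∈ Set.Icc 1 M.T, ∀ e, 0 < e → b t e = β t e) := by
  have hκ := inv_snr_pos hV hP
  refine ⟨fun t ht e he => ?_, fun β hβ => ?_⟩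
  · simp only [isThreshold_iff hpX hX ht]
    exact existsUnique_isBalanced hpX (hX.integrable_density hpX ht) hκ.le
      (oppCost_nonneg hpX hX hV hP he)
  have hbal : ∀ t ∈ Set.Icc 1 M.T, ∀ e, 0 < e →
      IsBalanced pX (1 / (M.snr + 1)) (M.oppCost t e) (β t e) := fun t ht e he =>
    (isThreshold_iff hpX hX ht).1 (hβ t ht e he)
  have hadm : M.Admissible (thresholdStrategy β) :=
    admissible_thresholdStrategy hpX hX fun t ht e he =>
      (hbal t ht e he).pos hpX (hX.integrable_density hpX ht) hκ
        (oppCost_nonneg hpX hX hV hP he)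
  have hopt : ∀ t, 1 ≤ t → ∀ e, M.costToGo (thresholdStrategy β) t e = M.optCost t e :=
    fun t ht => (optimal_thresholdStrategy hpX hX hV hP hadm
      (fun t ht e he _ => hbal t ht e he) _ t ht rfl).1
  refine ⟨hadm, fun N f hf => ?_, fun t ht e => hopt t ht.1 e, fun b hb hbopt t ht e he => ?_⟩
  · rw [hopt 1 le_rfl N]
    exact optCost_le hf 1 N
  · have hi := hX.integrable_density hpX ht
    have hsil := silentSet_thresholdStrategy b t he
    -- a negative threshold is never silent
    have hb0 : 0 ≤ b t e := by
      by_contra! hneg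
      have := hb.silent_pos t ht e he
      rw [silent_eq, hsil, Set.Icc_eq_empty (by linarith)] at this
      simp at this
    have hnext : ∀ e, M.costToGo (thresholdStrategy b) (t + 1) e = M.optCost (t + 1) e := by
      intro e
      rcases Nat.lt_or_ge M.T (t + 1) with hlt | hle
      · rw [← hopt (t + 1) (by omega) e, costToGo_of_lt _ hlt, costToGo_of_lt _ hlt]
      · exact hbopt (t + 1) ⟨by omega, hle⟩ e
    have hval := hbopt t ht e
    rw [(optCost_step hpX hX hV hP hadm ht (hopt (t + 1) (by omega)) (hbal t ht)).2.2 e he,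
      costToGo_step hpX hX hV hP hb.measurable ht, hnext, hnext,
      stageCost_add hpX hX ht (measurableSet_silentSet (hb.measurable t ht e)), hsil] at hval
    have heq := add_left_cancel hval
    by_contra hne
    exact (thresholdCost_lt hpX hi hκ.le (hbal t ht e he) hb0 hne).ne' heq
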